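/- Decoupling transformation. Let $l,j\ge 0$ and $n\ge 1$ be integers, $\mathbb T^l=\mathbb R^l/\mathbb Z^l$, $M\subseteq\mathbb R^j$ open and $a>0$. Let $\omega_0\in\mathcal D(c,\mu)$ for some $c,\mu>0$, where $$\mathcal D(c,\mu)=\{\omega\in\mathbb R^l:\ |m\cdot\omega-k|\ge c\,|m|^{-\mu}\ \ \forall\, m\in\mathbb Z^l\setminus\{0\},\ k\in\mathbb Z\},$$ and $|m|$ is the maximum norm. Let $\bar F^{(i)}:M\to\mathbb R^l$, $\bar G^{(i)}:M\to\mathbb R^j$ ($1\le i\le n-1$) be real analytic, and let $F^{(n)}:\mathbb T^l\times M\times(-a,a)\to\mathbb R^l$ and $G^{(n)}:\mathbb T^l\times M\times(-a,a)\to\mathbb R^j$ be real analytic in all arguments $(\theta,J;\kappa)$. For $|\kappa|<a$ let $f_\kappa:(\theta,J)\mapsto(\theta',J')$ be the map from $\mathbb T^l\times M$ to $\mathbb T^l\times\mathbb R^j$ given by $$\theta'=\theta+\omega_0+\sum_{i=1}^{n-1}\kappa^i\bar F^{(i)}(J)+\kappa^nF^{(n)}(\theta,J;\kappa),\qquad J'=J+\sum_{i=1}^{n-1}\kappa^i\bar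 G^{(i)}(J)+\kappa^nG^{(n)}(\theta,J;\kappa).$$ Put $\bar F^{(n)}(I)=\int_{\mathbb T^l}F^{(n)}(\theta,I;0)\,d\theta$ and $\bar G^{(n)}(I)=\int_{\mathbb T^l}G^{(n)}(\theta,I;0)\,d\theta$. Then there are real analytic maps $T^{(n)}:\mathbb T^l\times M\to\mathbb R^l$ and $S^{(n)}:\mathbb T^l\times M\to\mathbb R^j$, independent of $\kappa$, such that for every compact $K\subseteq M$ there are $\kappa_0\in(0,a]$, open sets $U,V$ with $K\subseteq U\subseteq V\subseteq M$, and real analytic maps $F^{(n+1)}:\mathbb T^l\times U\times(-\kappa_0,\kappa_0)\to\mathbb R^l$ and $G^{(n+1)}:\mathbb T^l\times U\times(-\kappa_0,\kappa_0)\to\mathbb R^j$ with the following property. For every $\kappa$ with $|\kappa|<\kappa_0$ the formula $$(\theta,J)=\bigl(\psi+\kappa^nT^{(n)}(\psi,I),\ I+\kappa^nS^{(n)}(\psi,I)\bigr)$$ defines the inverse of an analytic diffeomorphism $h_\kappa:(\theta,J)\mapsto(\psi,I)$ from an open subset of $\mathbb T^l\times M$ onto $\mathbb T^l\times V$; moreover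 $\mathbb T^l\times K\subseteq h_\kappa^{-1}(\mathbb T^l\times U)$; and on $\mathbb T^l\times U$ the map $h_\kappa\circ f_\kappa\circ h_\kappa^{-1}$ is defined and equals $(\psi,I)\mapsto(\psi',I')$ with $$\psi'=\psi+\omega_0+\sum_{i=1}^{n}\kappa^i\bar F^{(i)}(I)+\kappa^{n+1}F^{(n+1)}(\psi,I;\kappa),\qquad I'=I+\sum_{i=1}^{n}\kappa^i\bar G^{(i)}(I)+\kappa^{n+1}G^{(n+1)}(\psi,I;\kappa).$$ -/

import Mathlib

open Set Topology MeasureTheory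

/-- The Diophantine frequency vectors `𝒟(c, μ) ⊆ ℝ^l`, with the maximum norm `‖m‖` on `ℤ^l`:
`|m · ω - k| ≥ c ‖m‖^(-μ)` for all nonzero `m ∈ ℤ^l` and all `k ∈ ℤ`. -/
def diophantine (l : ℕ) (c μ : ℝ) : Set (Fin l → ℝ) :=
  {ω | ∀ (m : Fin l → ℤ) (k : ℤ), m ≠ 0 →
    c * ‖m‖ ^ (-μ) ≤ |(∑ i, (m i : ℝ) * ω i) - (k : ℝ)|}

/-- The projection `ℝ^l → 𝕋^l = (ℝ/ℤ)^l`. -/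
def torusMk {l : ℕ} (x : Fin l → ℝ) : UnitAddTorus (Fin l) :=
  fun i => (x i : UnitAddCircle)

/-- The phase space `𝕋^l × ℝ^j` of fast angles and slow variables. -/
abbrev Phase (l j : ℕ) : Type := UnitAddTorus (Fin l) × (Fin j → ℝ)

/-- The covering map `ℝ^l × ℝ^j → 𝕋^l × ℝ^j`. -/
def phaseMk {l j : ℕ} (p : (Fin l → ℝ) × (Fin j → ℝ)) : Phase l j :=
  (torusMk p.1, p.2)

/-- A vector-valued function `u` on `𝕋^l × X` is real analytic on `𝕋^l × A`: its lift to
`ℝ^l × X` is analytic at every point of `ℝ^l × A`. -/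
def TorusAnalyticOn {l : ℕ} {X E : Type*} [NormedAddCommGroup X] [NormedSpace ℝ X]
    [NormedAddCommGroup E] [NormedSpace ℝ E]
    (u : UnitAddTorus (Fin l) × X → E) (A : Set X) : Prop :=
  AnalyticOnNhd ℝ (fun p : (Fin l → ℝ) × X => u (torusMk p.1, p.2)) (univ ×ˢ A)

/-- A map `g` of `𝕋^l × ℝ^j` into itself is real analytic on the open set `A`: near every point
it is analytic in the local coordinates that the covering `ℝ^l × ℝ^j → 𝕋^l × ℝ^j` provides. -/
def PhaseAnalyticOn {l j : ℕ} (g : Phase l j → Phase l j) (A : Set (Phase l j)) : Prop :=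
  ∀ p : (Fin l → ℝ) × (Fin j → ℝ), phaseMk p ∈ A →
    ∃ gl : (Fin l → ℝ) × (Fin j → ℝ) → (Fin l → ℝ) × (Fin j → ℝ),
      AnalyticAt ℝ gl p ∧ ∀ᶠ q in 𝓝 p, g (phaseMk q) = phaseMk (gl q)

/-- A homeomorphism between open sets of `𝕋^l × ℝ^j` is an analytic diffeomorphism: it and its
inverse are real analytic. -/
def IsAnalyticDiffeo {l j : ℕ} (h : OpenPartialHomeomorph (Phase l j) (Phase l j)) : Prop :=
  PhaseAnalyticOn h h.source ∧ PhaseAnalyticOn h.symm h.target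

/-- The average `J ↦ ∫_{𝕋^l} u(θ, J; 0) dθ` over the angles, at `κ = 0`. -/
noncomputable def angleAverage {l j : ℕ} {E : Type*} [NormedAddCommGroup E] [NormedSpace ℝ E]
    (u : UnitAddTorus (Fin l) × ((Fin j → ℝ) × ℝ) → E) (J : Fin j → ℝ) : E :=
  ∫ θ : UnitAddTorus (Fin l), u (θ, (J, 0))

/-- The map, for the parameter value `κ`, whose angle dependence begins at order `κ^r`:
`θ' = θ + ω₀ + ∑_{1 ≤ i < r} κ^i Fb i (J) + κ^r F(θ, J; κ)`,
`J' = J + ∑_{1 ≤ i < r} κ^i Gb i (J) + κ^r G(θ, J; κ)`. -/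
noncomputable def averagedMap {l j : ℕ} (ω₀ : Fin l → ℝ) (r : ℕ)
    (Fb : ℕ → (Fin j → ℝ) → (Fin l → ℝ)) (Gb : ℕ → (Fin j → ℝ) → (Fin j → ℝ))
    (F : UnitAddTorus (Fin l) × ((Fin j → ℝ) × ℝ) → (Fin l → ℝ))
    (G : UnitAddTorus (Fin l) × ((Fin j → ℝ) × ℝ) → (Fin j → ℝ))
    (κ : ℝ) (x : Phase l j) : Phase l j :=
  (x.1 + torusMk (ω₀ + (∑ i ∈ Finset.Ico 1 r, κ ^ i • Fb i x.2) + κ ^ r • F (x.1, (x.2, κ))),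
    x.2 + (∑ i ∈ Finset.Ico 1 r, κ ^ i • Gb i x.2) + κ ^ r • G (x.1, (x.2, κ)))

/-! Substitute θ = ψ + κⁿT(ψ, I), J = I + κⁿS(ψ, I) into `f_κ`. For κ = 0 the map is the rotation by
ω₀, so the angle-dependent terms of order κⁿ in ψ' are F(ψ, I; 0) + T(ψ, I) − T(ψ + ω₀, I), and
likewise for I' with G and S. The lower-order averages only contribute errors κ^i (B_i(I + κⁿS) −
B_i(I)) with i ≥ 1, which are of order κ^(n+1). Hence only the mean survives at order n if T and S
solve the homological equation T(ψ + ω₀) − T(ψ) = F − ∫F (`exists_homologicalSolution`).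

Formally the m-th Fourier coefficient is divided by exp(2πi m·ω₀) − 1, of modulus at least
4c|m|^(−μ). Analyticity jointly in the angle and the slow variable is obtained without
complexification: with L = ∑ ∂ᵢ^(4N) and 4N > μ + l, the multiplier 1/(symbol of L · (exp(2πi m·ω₀)
− 1)) is summable, so it is the multiplier of a continuous kernel, and T is the convolution of this
kernel with Lu. All variables then enter through the analytic function Lu alone, and integrals of
analytic functions over compact sets are analytic in parameters
(`analyticAt_setIntegral_of_isCompact`).

On the covering space with κ as an extra coordinate, the near-identity map has a shear as derivative
at κ = 0. The analytic inverse function theorem gives local inverses analytic jointly in κ, and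
compactness of 𝕋^l × K makes the range of κ uniform. The terms of order n minus their mean thus form
a jointly analytic function vanishing at κ = 0, hence divisible by κ
(`TorusAnalyticOn.exists_eq_smul`); the quotient enters the new remainder. -/

/-! ### Analyticity of integrals depending on a parameter. -/

section ParametricIntegral

open scoped NNReal ENNReal

variable {E₁ E₂ F : Type*} [NormedAddCommGroup E₁] [NormedSpace ℝ E₁]
  [NormedAddCommGroup E₂] [NormedSpace ℝ E₂] [NormedAddCommGroup F] [NormedSpace ℝ F]
  [CompleteSpace F]

/-- The expansion in the second variable of a power series in two variables, after its centre has
been moved in the first variable. -/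
noncomputable def partialSeries (p : FormalMultilinearSeries ℝ (E₁ × E₂) F) (w : E₁) :
    FormalMultilinearSeries ℝ E₂ F := fun n =>
  (p.changeOrigin (w, 0) n).compContinuousLinearMap fun _ => ContinuousLinearMap.inr ℝ E₁ E₂

/-- A bound of the coefficients of `p.changeOrigin w` for `‖w‖ ≤ ρ`. -/
noncomputable def changeOriginBound {E : Type*} [NormedAddCommGroup E] [NormedSpace ℝ E]
    (p : FormalMultilinearSeries ℝ E F) (ρ : ℝ≥0) (n : ℕ) : ℝ≥0 :=
  ∑' s : Σ l : ℕ, { s : Finset (Fin (n + l)) // s.card = l }, ‖p (n + s.1)‖₊ * ρ ^ s.1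

-- Restriction to the second factor does not increase norms, so the bound is uniform in the moved
-- centre. This uniformity is what permits integration of the coefficients.
omit [CompleteSpace F] in
lemma nnnorm_partialSeries_le (p : FormalMultilinearSeries ℝ (E₁ × E₂) F) {ρ : ℝ≥0}
    (hρ : (ρ : ℝ≥0∞) < p.radius) {w : E₁} (hw : ‖w‖₊ ≤ ρ) (n : ℕ) :
    ‖partialSeries p w n‖₊ ≤ changeOriginBound p ρ n := by
  have hw' : ‖((w, 0) : E₁ × E₂)‖₊ ≤ ρ := by
    simpa [Prod.nnnorm_def] using hw
  have h1 : ‖partialSeries p w n‖₊ ≤ ‖p.changeOrigin (w, 0) n‖₊ := by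
    rw [← NNReal.coe_le_coe]
    refine (ContinuousMultilinearMap.norm_compContinuousLinearMap_le _ _).trans ?_
    refine mul_le_of_le_one_right (norm_nonneg _) ?_
    exact Finset.prod_le_one (fun _ _ => norm_nonneg _)
      (fun _ _ => ContinuousLinearMap.norm_inr_le_one ℝ E₁ E₂)
  refine h1.trans ((p.nnnorm_changeOrigin_le n ?_).trans ?_)
  · exact lt_of_le_of_lt (by exact_mod_cast hw') hρ
  · refine Summable.tsum_le_tsum (fun s => by gcongr) ?_ (p.changeOriginSeries_summable_aux₂ hρ n)
    exact p.changeOriginSeries_summable_aux₂ (lt_of_le_of_lt (by exact_mod_cast hw') hρ) n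

omit [CompleteSpace F] in
lemma summable_changeOriginBound {E : Type*} [NormedAddCommGroup E] [NormedSpace ℝ E]
    (p : FormalMultilinearSeries ℝ E F) {ρ ρ' : ℝ≥0} (hρ : (ρ + ρ' : ℝ≥0∞) < p.radius) :
    Summable fun n => changeOriginBound p ρ n * ρ' ^ n := by
  simpa only [changeOriginBound, ← NNReal.tsum_mul_right] using
    (NNReal.summable_sigma.1 (p.changeOriginSeries_summable_aux₁ hρ)).2

lemma hasSum_partialSeries {g : E₁ × E₂ → F} {p : FormalMultilinearSeries ℝ (E₁ × E₂) F}
    {y₀ : E₁} {x₀ : E₂} {r : ℝ≥0∞} (hp : HasFPowerSeriesOnBall g p (y₀, x₀) r) {ρ ρ' : ℝ≥0}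
    (hρ : (ρ + ρ' : ℝ≥0∞) < r) {w : E₁} (hw : ‖w‖₊ ≤ ρ) {z : E₂} (hz : ‖z‖₊ ≤ ρ') :
    HasSum (fun n => partialSeries p w n fun _ => z) (g (y₀ + w, x₀ + z)) := by
  have hw' : ‖((w, 0) : E₁ × E₂)‖₊ ≤ ρ := by simpa [Prod.nnnorm_def] using hw
  have hz' : ‖((0, z) : E₁ × E₂)‖₊ ≤ ρ' := by simpa [Prod.nnnorm_def] using hz
  have hlt : (‖((w, 0) : E₁ × E₂)‖₊ : ℝ≥0∞) < r :=
    lt_of_le_of_lt (by exact_mod_cast hw') (lt_of_le_of_lt le_self_add hρ)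
  have h := (hp.changeOrigin hlt).hasSum (y := (0, z)) (by
    rw [Metric.mem_eball, edist_zero_right, enorm_eq_nnnorm, lt_tsub_iff_left]
    refine lt_of_le_of_lt ?_ hρ
    gcongr)
  simpa [partialSeries, ContinuousMultilinearMap.compContinuousLinearMap_apply] using h

lemma continuousOn_partialSeries (p : FormalMultilinearSeries ℝ (E₁ × E₂) F) {ρ : ℝ≥0}
    (hρ : (ρ : ℝ≥0∞) < p.radius) (n : ℕ) :
    ContinuousOn (fun w => partialSeries p w n) (Metric.closedBall 0 ρ) := by
  have h1 := (p.hasFPowerSeriesOnBall_changeOrigin n (lt_of_le_of_lt zero_le hρ)).continuousOn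
  have h2 : ContinuousOn (fun w : E₁ => p.changeOrigin (w, 0) n) (Metric.closedBall 0 ρ) := by
    refine h1.comp (f := fun w : E₁ => ((w, 0) : E₁ × E₂)) (by fun_prop) ?_
    intro w hw
    rw [Metric.mem_eball, edist_zero_right, enorm_eq_nnnorm]
    refine lt_of_le_of_lt ?_ hρ
    have : ‖w‖₊ ≤ ρ := by simpa [← NNReal.coe_le_coe] using hw
    exact_mod_cast (show ‖((w, 0) : E₁ × E₂)‖₊ ≤ ρ by simpa [Prod.nnnorm_def] using this)
  exact (ContinuousMultilinearMap.compContinuousLinearMapL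
    (fun _ : Fin n => ContinuousLinearMap.inr ℝ E₁ E₂)).continuous.comp_continuousOn h2

variable [MeasurableSpace E₁] [BorelSpace E₁] [SecondCountableTopology E₁]

/-- Near `y₀` the function is expanded in `x` with coefficients continuous in `y`; dominated
summation lets the coefficients be integrated. All measurable subsets of one ball are treated at
once, and integrability is recorded, so that local results can later be added over disjoint pieces.
-/
lemma HasFPowerSeriesOnBall.exists_analyticAt_setIntegral {g : E₁ × E₂ → F}
    {p : FormalMultilinearSeries ℝ (E₁ × E₂) F} {y₀ : E₁} {x₀ : E₂} {r : ℝ≥0∞}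
    (hp : HasFPowerSeriesOnBall g p (y₀, x₀) r)
    (ν : Measure E₁) [IsFiniteMeasure ν] {k : E₁ → ℝ} (hk : Measurable k) {B : ℝ}
    (hB : ∀ y, |k y| ≤ B) :
    ∃ δ > 0, ∀ t : Set E₁, MeasurableSet t → t ⊆ Metric.closedBall y₀ δ →
      (∀ᶠ x in 𝓝 x₀, IntegrableOn (fun y => k y • g (y, x)) t ν) ∧
      AnalyticAt ℝ (fun x => ∫ y in t, k y • g (y, x) ∂ν) x₀ := by
  -- One `ρ` is spent on moving the centre in `y`, the other on evaluating in `x`.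
  obtain ⟨ρ, hρ0, hρ⟩ : ∃ ρ : ℝ≥0, 0 < ρ ∧ (ρ + ρ : ℝ≥0∞) < r := by
    obtain ⟨a, ha0, ha⟩ := ENNReal.lt_iff_exists_nnreal_btwn.1 hp.r_pos
    refine ⟨a / 2, by simpa using ha0, ?_⟩
    rw [← ENNReal.coe_add, add_halves]
    exact ha
  have hρr : (ρ + ρ : ℝ≥0∞) < p.radius := lt_of_lt_of_le hρ hp.r_le
  have hρ1 : (ρ : ℝ≥0∞) < p.radius := lt_of_le_of_lt le_self_add hρr
  have hB0 : 0 ≤ B := (abs_nonneg _).trans (hB 0)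
  refine ⟨ρ, by exact_mod_cast hρ0, fun t ht hts => ?_⟩
  have hw : ∀ y ∈ t, ‖y - y₀‖₊ ≤ ρ := fun y hy => by
    have := hts hy
    rwa [Metric.mem_closedBall, dist_eq_norm, ← coe_nnnorm, NNReal.coe_le_coe] at this
  have hmeas : ∀ n, AEStronglyMeasurable (fun y => k y • partialSeries p (y - y₀) n)
      (ν.restrict t) := by
    intro n
    refine hk.aestronglyMeasurable.smul ?_
    refine ContinuousOn.aestronglyMeasurable ?_ ht
    refine (continuousOn_partialSeries p hρ1 n).comp (by fun_prop) ?_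
    intro y hy
    simpa [dist_eq_norm] using hts hy
  have hbd : ∀ n, ∀ y ∈ t, ‖k y • partialSeries p (y - y₀) n‖ ≤ B * changeOriginBound p ρ n := by
    intro n y hy
    rw [norm_smul, Real.norm_eq_abs]
    refine mul_le_mul (hB y) ?_ (norm_nonneg _) hB0
    exact_mod_cast nnnorm_partialSeries_le p hρ1 (hw y hy) n
  have hint : ∀ n, Integrable (fun y => k y • partialSeries p (y - y₀) n) (ν.restrict t) :=
    fun n => Integrable.of_bound (hmeas n) (B * changeOriginBound p ρ n)
      ((ae_restrict_iff' ht).2 (Filter.Eventually.of_forall (hbd n)))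
  have hsum := (summable_changeOriginBound p hρr)
  have hsumR : Summable fun n => B * (changeOriginBound p ρ n * ρ ^ n : ℝ) :=
    Summable.mul_left B (by exact_mod_cast hsum)
  have hterm : ∀ z : E₂, ‖z‖₊ ≤ ρ → ∀ n, ∀ y ∈ t,
      ‖k y • partialSeries p (y - y₀) n fun _ => z‖ ≤
        B * (changeOriginBound p ρ n * ρ ^ n : ℝ) := by
    intro z hz n y hy
    have h1 := (k y • partialSeries p (y - y₀) n).le_opNorm (fun _ => z)
    rw [smul_apply] at h1
    refine h1.trans ?_
    rw [← mul_assoc]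
    refine mul_le_mul (hbd n y hy) ?_ (by positivity) (by positivity)
    simp only [Finset.prod_const, Finset.card_univ, Fintype.card_fin]
    gcongr
    exact_mod_cast hz
  have hI1 : ∀ z : E₂, ∀ n, Integrable (fun y => k y • partialSeries p (y - y₀) n fun _ => z)
      (ν.restrict t) := fun z n =>
    (ContinuousMultilinearMap.apply ℝ (fun _ : Fin n => E₂) F (fun _ => z)).integrable_comp (hint n)
  have hnorm : ∀ z : E₂, ‖z‖₊ ≤ ρ →
      Summable fun n => ∫ y in t, ‖k y • partialSeries p (y - y₀) n fun _ => z‖ ∂ν := by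
    intro z hz
    refine Summable.of_nonneg_of_le (fun n => integral_nonneg fun _ => norm_nonneg _) (fun n => ?_)
      (hsumR.mul_right (ν.real t))
    have := setIntegral_mono_on (hI1 z n).norm
      (integrable_const (B * (changeOriginBound p ρ n * ρ ^ n : ℝ))) ht (hterm z hz n)
    simpa [mul_comm] using this
  have hpt : ∀ z : E₂, ‖z‖₊ ≤ ρ → ∀ y ∈ t,
      HasSum (fun n => k y • partialSeries p (y - y₀) n fun _ => z) (k y • g (y, x₀ + z)) := by
    intro z hz y hy
    have := hasSum_partialSeries hp hρ (hw y hy) hz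
    rw [add_sub_cancel] at this
    exact this.const_smul (k y)
  constructor
  · filter_upwards [Metric.closedBall_mem_nhds x₀ (show (0 : ℝ) < ρ by exact_mod_cast hρ0)]
      with x hx
    have hz : ‖x - x₀‖₊ ≤ ρ := by
      rwa [Metric.mem_closedBall, dist_eq_norm, ← coe_nnnorm, NNReal.coe_le_coe] at hx
    have hm : AEStronglyMeasurable (fun y => k y • g (y, x)) (ν.restrict t) := by
      refine aestronglyMeasurable_of_tendsto_ae Filter.atTop
        (f := fun N y => ∑ n ∈ Finset.range N, k y • partialSeries p (y - y₀) n fun _ => x - x₀)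
        (fun N => Finset.aestronglyMeasurable_fun_sum _ fun n _ => (hI1 _ n).1) ?_
      refine (ae_restrict_iff' ht).2 (Filter.Eventually.of_forall fun y hy => ?_)
      simpa using (hpt _ hz y hy).tendsto_sum_nat
    refine Integrable.of_bound hm (∑' n, B * (changeOriginBound p ρ n * ρ ^ n : ℝ)) ?_
    refine (ae_restrict_iff' ht).2 (Filter.Eventually.of_forall fun y hy => ?_)
    have h1 := hpt _ hz y hy
    rw [add_sub_cancel] at h1
    rw [← h1.tsum_eq]
    exact tsum_of_norm_bounded hsumR.hasSum (fun n => hterm _ hz n y hy)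
  · refine ⟨fun n => ∫ y in t, k y • partialSeries p (y - y₀) n ∂ν, ρ, ?_, ?_, ?_⟩
    · refine FormalMultilinearSeries.le_radius_of_summable_norm _ ?_
      refine Summable.of_nonneg_of_le (fun n => by positivity) (fun n => ?_)
        (hsumR.mul_right (ν.real t))
      have := norm_setIntegral_le_of_norm_le_const (μ := ν) (s := t) (measure_lt_top ν t) (hbd n)
      calc _ ≤ (B * changeOriginBound p ρ n * ν.real t) * ρ ^ n := by gcongr
        _ = _ := by ring
    · exact_mod_cast hρ0
    · intro z hz
      have hz' : ‖z‖₊ ≤ ρ := by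
        rw [Metric.mem_eball, edist_zero_right, enorm_eq_nnnorm] at hz
        exact_mod_cast hz.le
      have h2 := hasSum_integral_of_summable_integral_norm (hI1 z) (hnorm z hz')
      have h3 : ∫ y in t, ∑' n, (k y • partialSeries p (y - y₀) n fun _ => z) ∂ν =
          ∫ y in t, k y • g (y, x₀ + z) ∂ν :=
        setIntegral_congr_fun ht fun y hy => (hpt z hz' y hy).tsum_eq
      rw [h3] at h2
      convert h2 using 2 with n
      rw [ContinuousMultilinearMap.integral_apply (hint n)]
      rfl

/-- The integral over a compact set of a function that depends analytically on a parameter,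
jointly with the variable of integration, is analytic in the parameter. -/
theorem analyticAt_setIntegral_of_isCompact {g : E₁ × E₂ → F} {K : Set E₁} (hK : IsCompact K)
    {x₀ : E₂} (hg : ∀ y ∈ K, AnalyticAt ℝ g (y, x₀)) (ν : Measure E₁) [IsFiniteMeasure ν]
    {k : E₁ → ℝ} (hk : Measurable k) {B : ℝ} (hB : ∀ y, |k y| ≤ B) {t : Set E₁}
    (ht : MeasurableSet t) (htK : t ⊆ K) :
    AnalyticAt ℝ (fun x => ∫ y in t, k y • g (y, x) ∂ν) x₀ := by
  -- The measurable superset is needed because compact induction runs over arbitrary sets.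
  -- Quantifying over all measurable subsets lets a union be split disjointly.
  let P : Set E₁ → Prop := fun s => ∃ s', s ⊆ s' ∧ MeasurableSet s' ∧
    ∀ t : Set E₁, MeasurableSet t → t ⊆ s' →
      (∀ᶠ x in 𝓝 x₀, IntegrableOn (fun y => k y • g (y, x)) t ν) ∧
      AnalyticAt ℝ (fun x => ∫ y in t, k y • g (y, x) ∂ν) x₀
  have hP : P K := by
    refine hK.induction_on (p := P) ?_ ?_ ?_ ?_
    · refine ⟨∅, Subset.rfl, MeasurableSet.empty, fun t _ ht => ?_⟩
      rw [subset_empty_iff.1 ht]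
      simp [analyticAt_const]
    · rintro s s' hs ⟨u, hu, h⟩
      exact ⟨u, hs.trans hu, h⟩
    · rintro s s' ⟨u, hu, hum, h⟩ ⟨u', hu', hum', h'⟩
      refine ⟨u ∪ u', union_subset_union hu hu', hum.union hum', fun t htm ht => ?_⟩
      have e : t = (t ∩ u) ∪ (t \ u) := (inter_union_sdiff t u).symm
      obtain ⟨h1, h2⟩ := h (t ∩ u) (htm.inter hum) inter_subset_right
      obtain ⟨h3, h4⟩ := h' (t \ u) (htm.diff hum) (by
        intro y hy
        exact (ht hy.1).resolve_left hy.2)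
      constructor
      · filter_upwards [h1, h3] with x hx hx'
        rw [e]
        exact hx.union hx'
      · refine (h2.add h4).congr ?_
        filter_upwards [h1, h3] with x hx hx'
        conv_rhs => rw [e]
        exact (setIntegral_union disjoint_sdiff_inter.symm (htm.diff hum) hx hx').symm
    · intro y hy
      obtain ⟨p, r, hp⟩ := hg y hy
      obtain ⟨δ, hδ, h⟩ := hp.exists_analyticAt_setIntegral ν hk hB
      exact ⟨Metric.closedBall y δ, mem_nhdsWithin_of_mem_nhds (Metric.closedBall_mem_nhds y hδ),
        _, Subset.rfl, Metric.isClosed_closedBall.measurableSet, h⟩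
  obtain ⟨s', hs, -, h⟩ := hP
  exact (h t ht (htK.trans hs)).2

end ParametricIntegral

/-! ### The covering of the torus and of the phase space. -/

section TorusCovering

variable {l j : ℕ}

lemma torusMk_add (x y : Fin l → ℝ) : torusMk (x + y) = torusMk x + torusMk y := by
  ext i; simp [torusMk]

lemma torusMk_sub (x y : Fin l → ℝ) : torusMk (x - y) = torusMk x - torusMk y := by
  ext i; simp [torusMk]

lemma torusMk_zero : torusMk (0 : Fin l → ℝ) = 0 := by
  ext i; simp [torusMk]

lemma continuous_torusMk : Continuous (torusMk : (Fin l → ℝ) → _) :=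
  continuous_pi fun i => (AddCircle.continuous_mk' 1).comp (continuous_apply i)

lemma torusMk_surjective : Function.Surjective (torusMk : (Fin l → ℝ) → _) := by
  intro θ
  choose x hx using fun i => QuotientAddGroup.mk_surjective (θ i)
  exact ⟨x, funext hx⟩

lemma isOpenMap_torusMk : IsOpenMap (torusMk : (Fin l → ℝ) → _) :=
  IsOpenMap.piMap (f := fun _ : Fin l => ((↑) : ℝ → UnitAddCircle))
    (fun _ => QuotientAddGroup.isOpenMap_coe) (by
      exact Filter.Eventually.of_forall fun i => QuotientAddGroup.mk_surjective)

lemma eq_of_torusMk_eq {x y : Fin l → ℝ} (h : torusMk x = torusMk y) (hxy : ‖x - y‖ < 1) :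
    x = y := by
  ext i
  have h1 : ((x i : ℝ) : UnitAddCircle) = (y i : ℝ) := congrFun h i
  obtain ⟨n, hn⟩ := AddSubgroup.mem_zmultiples_iff.1 (QuotientAddGroup.eq_iff_sub_mem.1 h1)
  have h2 : |x i - y i| < 1 := (norm_le_pi_norm (x - y) i).trans_lt hxy
  simp only [zsmul_eq_mul, mul_one] at hn
  rw [← hn] at h2
  have : n = 0 := by
    rw [← Int.abs_lt_one_iff]
    exact_mod_cast h2
  rw [this] at hn
  simp at hn
  linarith

lemma continuous_phaseMk : Continuous (phaseMk : _ → Phase l j) :=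
  (continuous_torusMk.comp continuous_fst).prodMk continuous_snd

lemma isOpenMap_phaseMk : IsOpenMap (phaseMk : _ → Phase l j) :=
  isOpenMap_torusMk.prodMap IsOpenMap.id

lemma phaseMk_surjective : Function.Surjective (phaseMk : _ → Phase l j) := by
  rintro ⟨θ, J⟩
  obtain ⟨x, rfl⟩ := torusMk_surjective θ
  exact ⟨(x, J), rfl⟩

end TorusCovering

/-! ### Fourier series and small divisors on the torus. -/

section FourierSeries

open UnitAddTorus

variable {l : ℕ}

/-- The normalized Haar measure of the torus. -/
noncomputable abbrev torusHaar (l : ℕ) : Measure (UnitAddTorus (Fin l)) :=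
  Measure.pi fun _ => AddCircle.haarAddCircle

lemma volume_eq_torusHaar (l : ℕ) : (volume : Measure (UnitAddTorus (Fin l))) = torusHaar l := by
  have : (volume : Measure UnitAddCircle) = AddCircle.haarAddCircle := by
    rw [AddCircle.volume_eq_smul_haarAddCircle]; simp
  rw [volume_pi, this]

lemma integral_torusHaar_eq {E : Type*} [NormedAddCommGroup E] [NormedSpace ℝ E]
    (f : UnitAddTorus (Fin l) → E) :
    ∫ θ, f θ ∂torusHaar l = ∫ x in {x : Fin l → ℝ | ∀ i, x i ∈ Ioc 0 1}, f (torusMk x) := by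
  have h := integral_preimage f 0
  simp only [Pi.zero_apply, zero_add] at h
  exact h

lemma mFourier_apply_add (m : Fin l → ℤ) (θ φ : UnitAddTorus (Fin l)) :
    mFourier m (θ + φ) = mFourier m θ * mFourier m φ := by
  simp [mFourier, fourier_apply, AddCircle.toCircle_add, Finset.prod_mul_distrib]

lemma mFourier_apply_neg (m : Fin l → ℤ) (θ : UnitAddTorus (Fin l)) :
    mFourier m (-θ) = mFourier (-m) θ := by
  simp [mFourier, fourier_apply]

lemma norm_mFourier_apply (m : Fin l → ℤ) (θ : UnitAddTorus (Fin l)) : ‖mFourier m θ‖ = 1 := by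
  simp only [mFourier, ContinuousMap.coe_mk, fourier_apply, norm_prod, Circle.norm_coe,
    Finset.prod_const_one]

lemma mFourier_torusMk (m : Fin l → ℤ) (x : Fin l → ℝ) :
    mFourier m (torusMk x) = Complex.exp (Complex.I * ((2 * Real.pi * ∑ i, m i * x i : ℝ))) := by
  simp only [mFourier, torusMk, ContinuousMap.coe_mk, fourier_coe_apply, ← Complex.exp_sum]
  congr 1
  push_cast
  simp only [Finset.mul_sum]
  refine Finset.sum_congr rfl fun i _ => ?_
  ring

/-- With z the signed distance of m·ω to the nearest integer, |exp(2πiz) − 1| = 2|sin πz| ≥ 4|z| by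
Jordan's inequality for |z| ≤ 1/2. -/
lemma le_norm_mFourier_sub_one {c μ : ℝ} {ω : Fin l → ℝ} (hω : ω ∈ diophantine l c μ)
    {m : Fin l → ℤ} (hm : m ≠ 0) :
    4 * (c * ‖m‖ ^ (-μ)) ≤ ‖mFourier m (torusMk ω) - 1‖ := by
  set y : ℝ := ∑ i, (m i : ℝ) * ω i with hy
  have h1 := hω m (round y) hm
  set z := y - round y with hz
  have hz2 : |z| ≤ 1 / 2 := abs_sub_round y
  have e : mFourier m (torusMk ω) = Complex.exp (Complex.I * ((2 * Real.pi * z : ℝ))) := by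
    rw [mFourier_torusMk, ← hy, Complex.exp_eq_exp_iff_exists_int]
    refine ⟨round y, ?_⟩
    rw [hz]
    push_cast
    ring
  rw [e, Complex.norm_exp_I_mul_ofReal_sub_one, show 2 * Real.pi * z / 2 = Real.pi * z by ring,
    Real.norm_eq_abs, abs_mul, abs_two]
  have h3 := Real.mul_abs_le_abs_sin (x := Real.pi * z) (by
    rw [abs_mul, abs_of_pos Real.pi_pos]; nlinarith [Real.pi_pos])
  rw [abs_mul, abs_of_pos Real.pi_pos, ← mul_assoc, div_mul_cancel₀ _ Real.pi_ne_zero] at h3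
  linarith

/-- ℤ^l is embedded as a lattice of rank l in ℝ^l, with the same maximum norm. -/
lemma summable_norm_rpow_int (l : ℕ) {r : ℝ} (hr : r < -l) :
    Summable fun m : Fin l → ℤ => ‖m‖ ^ r := by
  let L := Submodule.span ℤ (range (Pi.basisFun ℝ (Fin l)))
  have hfin : Module.finrank ℤ L = l := by
    have := Module.finrank_eq_card_basis ((Pi.basisFun ℝ (Fin l)).restrictScalars ℤ)
    simpa using this
  have h := ZLattice.summable_norm_rpow L r (by rwa [hfin])
  let f : (Fin l → ℤ) → L := fun m => ⟨fun i => (m i : ℝ), by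
    rw [(Pi.basisFun ℝ (Fin l)).mem_span_iff_repr_mem ℤ]
    intro i
    exact ⟨m i, by simp⟩⟩
  have hf : Function.Injective f := by
    intro m m' h
    ext i
    have := congrFun (congrArg Subtype.val h) i
    simpa [f] using this
  refine (h.comp_injective hf).congr fun m => ?_
  simp only [Function.comp, f]
  congr 1

lemma integrable_torusHaar_of_continuous {E : Type*} [NormedAddCommGroup E]
    {f : UnitAddTorus (Fin l) → E} (hf : Continuous f) : Integrable f (torusHaar l) :=
  hf.integrable_of_hasCompactSupport (HasCompactSupport.of_compactSpace f)

/-- The Fourier coefficients of a partial derivative. -/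
lemma mFourierCoeff_partialDeriv {f f' : UnitAddTorus (Fin l) → ℂ} (hf : Continuous f)
    (hf' : Continuous f') (i : Fin l)
    (h : ∀ θ, HasDerivAt (fun t : ℝ => f (θ + torusMk (Pi.single i t))) (f' θ) 0)
    (m : Fin l → ℤ) :
    mFourierCoeff f' m = (2 * Real.pi * Complex.I * m i) * mFourierCoeff f m := by
  have hpt : ∀ θ (t : ℝ), HasDerivAt
      (fun t : ℝ => f (θ + torusMk (Pi.single i t))) (f' (θ + torusMk (Pi.single i t))) t := by
    intro θ t
    have h1 := h (θ + torusMk (Pi.single i t))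
    have h2 := HasDerivAt.comp_sub_const t t (by simpa using h1)
    refine h2.congr_of_eventuallyEq (Filter.Eventually.of_forall fun s => ?_)
    simp only
    rw [add_assoc, ← torusMk_add, ← Pi.single_add]
    congr 4
    ring
  obtain ⟨C, hC⟩ : ∃ C, ∀ θ, ‖f' θ‖ ≤ C := by
    obtain ⟨C, hC⟩ := isCompact_univ.exists_bound_of_continuousOn hf'.continuousOn
    exact ⟨C, fun θ => hC θ (mem_univ _)⟩
  have hcs : Continuous fun t : ℝ => torusMk (Pi.single i t : Fin l → ℝ) :=
    continuous_torusMk.comp (continuous_single (A := fun _ : Fin l => ℝ) i)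
  -- In place of integration by parts, the m-th coefficient of the translate of `f` is
  -- differentiated in the translation `t`: once under the integral sign, once through its explicit
  -- factor exp(2πi mᵢ t).
  have key := (hasDerivAt_integral_of_dominated_loc_of_deriv_le (μ := torusHaar l)
    (F := fun (t : ℝ) θ => mFourier (-m) θ * f (θ + torusMk (Pi.single i t)))
    (F' := fun (t : ℝ) θ => mFourier (-m) θ * f' (θ + torusMk (Pi.single i t)))
    (x₀ := 0) (s := univ) (bound := fun _ => C) Filter.univ_mem
    (Filter.Eventually.of_forall fun t => (integrable_torusHaar_of_continuous
      (by fun_prop)).aestronglyMeasurable)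
    (integrable_torusHaar_of_continuous (by fun_prop))
    (integrable_torusHaar_of_continuous (by fun_prop)).aestronglyMeasurable
    (Filter.Eventually.of_forall fun θ t _ => by
      rw [norm_mul, norm_mFourier_apply, one_mul]; exact hC _)
    (integrable_const C)
    (Filter.Eventually.of_forall fun θ t _ => (hpt θ t).const_mul _)).2
  simp only [Pi.single_zero, torusMk_zero, add_zero] at key
  have hval : ∀ t : ℝ, ∫ θ, mFourier (-m) θ * f (θ + torusMk (Pi.single i t)) ∂torusHaar l =
      Complex.exp (2 * Real.pi * Complex.I * m i * t) * mFourierCoeff f m := by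
    intro t
    rw [← integral_add_right_eq_self _ (-torusMk (Pi.single i t))]
    simp only [mFourier_apply_add, neg_add_cancel_right, mFourier_apply_neg, neg_neg]
    have : mFourier m (torusMk (Pi.single i t)) = Complex.exp (2 * Real.pi * Complex.I * m i * t) := by
      rw [mFourier_torusMk, Finset.sum_eq_single i (by intro b _ hb; simp [hb]) (by simp)]
      congr 1
      push_cast
      simp
      ring
    rw [this, mFourierCoeff, ← integral_const_mul]
    refine integral_congr_ae (Filter.Eventually.of_forall fun θ => ?_)
    simp only [smul_eq_mul]
    ring
  have h2 : HasDerivAt (fun t : ℝ =>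
      Complex.exp (2 * Real.pi * Complex.I * m i * t) * mFourierCoeff f m)
      ((2 * Real.pi * Complex.I * m i) * mFourierCoeff f m) 0 := by
    have h3 : HasDerivAt (fun t : ℝ => 2 * Real.pi * Complex.I * m i * (t : ℂ))
        (2 * Real.pi * Complex.I * m i) 0 := by
      simpa using (Complex.ofRealCLM.hasDerivAt (x := 0)).const_mul (2 * Real.pi * Complex.I * m i)
    simpa using (h3.cexp).mul_const (mFourierCoeff f m)
  simp only [hval] at key
  exact key.unique h2

instance : (torusHaar l).IsNegInvariant := Measure.pi.isNegInvariant _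

lemma integral_mFourier_mul_sub (f : UnitAddTorus (Fin l) → ℂ) (m : Fin l → ℤ)
    (ψ : UnitAddTorus (Fin l)) :
    ∫ φ, mFourier m φ * f (ψ - φ) ∂torusHaar l = mFourier m ψ * mFourierCoeff f m := by
  rw [← integral_sub_left_eq_self _ _ ψ, mFourierCoeff, ← integral_const_mul]
  refine integral_congr_ae (Filter.Eventually.of_forall fun θ => ?_)
  beta_reduce
  rw [sub_sub_cancel, sub_eq_add_neg ψ, mFourier_apply_add, mFourier_apply_neg, smul_eq_mul]
  ring

/-- Absolute summability of `a` justifies termwise integration, and each character in the kernel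
picks out one Fourier mode of `f`. -/
lemma hasSum_mFourier_convolution {a : (Fin l → ℤ) → ℂ} (ha : Summable a)
    {f : UnitAddTorus (Fin l) → ℂ} (hf : Continuous f) (ψ : UnitAddTorus (Fin l)) :
    HasSum (fun m => a m * mFourier m ψ * mFourierCoeff f m)
      (∫ φ, (∑' m, a m * mFourier m φ) * f (ψ - φ) ∂torusHaar l) := by
  obtain ⟨C, hC⟩ : ∃ C, ∀ θ, ‖f θ‖ ≤ C := by
    obtain ⟨C, hC⟩ := isCompact_univ.exists_bound_of_continuousOn hf.continuousOn
    exact ⟨C, fun θ => hC θ (mem_univ _)⟩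
  have hint : ∀ m, Integrable (fun φ => a m * mFourier m φ * f (ψ - φ)) (torusHaar l) :=
    fun m => integrable_torusHaar_of_continuous (by fun_prop)
  have hnorm : ∀ m φ, ‖a m * mFourier m φ * f (ψ - φ)‖ ≤ ‖a m‖ * C := by
    intro m φ
    rw [norm_mul, norm_mul, norm_mFourier_apply, mul_one]
    gcongr
    exact hC _
  have h := hasSum_integral_of_summable_integral_norm hint (by
    refine Summable.of_nonneg_of_le (fun m => integral_nonneg fun _ => norm_nonneg _) (fun m => ?_)
      (ha.norm.mul_right C)
    simpa using integral_mono (hint m).norm (integrable_const _) (hnorm m))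
  have e : ∀ m, ∫ φ, a m * mFourier m φ * f (ψ - φ) ∂torusHaar l =
      a m * mFourier m ψ * mFourierCoeff f m := fun m => by
    rw [mul_assoc, ← integral_mFourier_mul_sub, ← integral_const_mul]
    simp only [mul_assoc]
  simp only [e, tsum_mul_right] at h
  exact h

lemma continuous_tsum_mFourier {a : (Fin l → ℤ) → ℂ} (ha : Summable a) :
    Continuous fun θ => ∑' m, a m * mFourier m θ :=
  continuous_tsum (fun m => by fun_prop) ha.norm (fun m θ => by
    rw [norm_mul, norm_mFourier_apply, mul_one])

end FourierSeries

/-! ### The homological equation over a Diophantine rotation. -/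

section HomologicalEquation

open UnitAddTorus

variable {l : ℕ} {X : Type*} [NormedAddCommGroup X] [NormedSpace ℝ X]

/-- The partial derivative with respect to the `i`-th angle. -/
noncomputable def torusDeriv (i : Fin l) (u : UnitAddTorus (Fin l) × X → ℝ) :
    UnitAddTorus (Fin l) × X → ℝ :=
  fun q => deriv (fun t : ℝ => u (q.1 + torusMk (Pi.single i t), q.2)) 0

/-- Identifies the angular derivative with a directional derivative of the lift, from which its
analyticity follows. -/
lemma torusDeriv_hasDerivAt_lift {u : UnitAddTorus (Fin l) × X → ℝ} {p : Fin l → ℝ} {x : X}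
    (hu : AnalyticAt ℝ (fun p : (Fin l → ℝ) × X => u (torusMk p.1, p.2)) (p, x)) (i : Fin l) :
    HasDerivAt (fun t : ℝ => u (torusMk p + torusMk (Pi.single i t), x))
      (fderiv ℝ (fun p : (Fin l → ℝ) × X => u (torusMk p.1, p.2)) (p, x) (Pi.single i 1, 0)) 0 := by
  have h1 : HasDerivAt (fun t : ℝ => ((p + Pi.single i t, x) : (Fin l → ℝ) × X))
      (Pi.single i 1, 0) 0 := by
    refine HasDerivAt.prodMk ?_ (hasDerivAt_const _ _)
    exact (hasDerivAt_single i (0 : ℝ)).const_add p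
  have h2 := hu.differentiableAt.hasFDerivAt
  have h3 := HasFDerivAt.comp_hasDerivAt_of_eq (0 : ℝ) h2 h1 (by simp)
  simpa only [Function.comp_def, torusMk_add] using h3

variable {u : UnitAddTorus (Fin l) × X → ℝ} {A : Set X}

lemma TorusAnalyticOn.hasDerivAt (hu : TorusAnalyticOn u A) (i : Fin l)
    (θ : UnitAddTorus (Fin l)) {x : X} (hx : x ∈ A) :
    HasDerivAt (fun t : ℝ => u (θ + torusMk (Pi.single i t), x)) (torusDeriv i u (θ, x)) 0 := by
  obtain ⟨p, rfl⟩ := torusMk_surjective θ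
  exact (torusDeriv_hasDerivAt_lift (hu (p, x) ⟨mem_univ _, hx⟩) i).differentiableAt.hasDerivAt

lemma TorusAnalyticOn.torusDeriv (hu : TorusAnalyticOn u A) (i : Fin l) :
    TorusAnalyticOn (torusDeriv i u) A := by
  rintro ⟨p, x⟩ hx
  have h := hu (p, x) hx
  have h1 : AnalyticAt ℝ (fun q => fderiv ℝ (fun p : (Fin l → ℝ) × X => u (torusMk p.1, p.2)) q
      (Pi.single i 1, 0)) (p, x) :=
    ((ContinuousLinearMap.apply ℝ ℝ ((Pi.single i 1, 0) : (Fin l → ℝ) × X)).analyticAt _).comp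
      h.fderiv
  refine h1.congr ?_
  filter_upwards [h.eventually_analyticAt] with q hq
  exact (torusDeriv_hasDerivAt_lift hq i).deriv.symm

lemma TorusAnalyticOn.torusDeriv_iterate (hu : TorusAnalyticOn u A) (i : Fin l) (k : ℕ) :
    TorusAnalyticOn ((_root_.torusDeriv i)^[k] u) A := by
  induction k with
  | zero => exact hu
  | succ k ih => rw [Function.iterate_succ_apply']; exact ih.torusDeriv i

lemma continuous_of_comp_torusMk {Y : Type*} [TopologicalSpace Y] {f : UnitAddTorus (Fin l) → Y}
    (hf : Continuous fun p => f (torusMk p)) : Continuous f :=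
  (isOpenMap_torusMk.isQuotientMap continuous_torusMk torusMk_surjective).continuous_iff.2 hf

lemma TorusAnalyticOn.continuous_angle {E : Type*} [NormedAddCommGroup E] [NormedSpace ℝ E]
    {u : UnitAddTorus (Fin l) × X → E} (hu : TorusAnalyticOn u A) {x : X} (hx : x ∈ A) :
    Continuous fun θ => u (θ, x) := by
  refine continuous_of_comp_torusMk (continuous_iff_continuousAt.2 fun p => ?_)
  exact ContinuousAt.comp (f := fun p : Fin l → ℝ => (p, x)) (x := p)
    (hu (p, x) ⟨mem_univ _, hx⟩).continuousAt (by fun_prop)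

lemma mFourierCoeff_torusDeriv_iterate (hu : TorusAnalyticOn u A) (i : Fin l) (k : ℕ) {x : X}
    (hx : x ∈ A) (m : Fin l → ℤ) :
    mFourierCoeff (fun θ => (((torusDeriv i)^[k] u (θ, x) : ℝ) : ℂ)) m =
      (2 * Real.pi * Complex.I * m i) ^ k * mFourierCoeff (fun θ => ((u (θ, x) : ℝ) : ℂ)) m := by
  induction k with
  | zero => simp
  | succ k ih =>
    have h := hu.torusDeriv_iterate i k
    rw [pow_succ', mul_assoc, ← ih]
    simp only [Function.iterate_succ_apply']
    exact mFourierCoeff_partialDeriv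
      (Complex.continuous_ofReal.comp (h.continuous_angle hx))
      (Complex.continuous_ofReal.comp ((h.torusDeriv i).continuous_angle hx)) i
      (fun θ => (h.hasDerivAt i θ hx).ofReal_comp) m

lemma mFourierCoeff_eq_integral_torusHaar (f : UnitAddTorus (Fin l) → ℂ) (m : Fin l → ℤ) :
    mFourierCoeff f m = ∫ θ, mFourier (-m) θ • f θ ∂torusHaar l := rfl

/-- The elliptic operator `∑ i, ∂ᵢ^(4 N)` in the angles. -/
noncomputable def torusElliptic (N : ℕ) (u : UnitAddTorus (Fin l) × X → ℝ) :
    UnitAddTorus (Fin l) × X → ℝ :=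
  fun q => ∑ i, (torusDeriv i)^[4 * N] u q

/-- The eigenvalues of `torusElliptic`. -/
noncomputable def ellipticSymbol (N : ℕ) (m : Fin l → ℤ) : ℝ :=
  ∑ i, (2 * Real.pi * m i) ^ (4 * N)

lemma TorusAnalyticOn.torusElliptic (hu : TorusAnalyticOn u A) (N : ℕ) :
    TorusAnalyticOn (torusElliptic N u) A := by
  intro p hp
  simp only [_root_.torusElliptic]
  exact Finset.univ.analyticAt_fun_sum fun i _ => hu.torusDeriv_iterate i (4 * N) p hp

/-- The order is a multiple of 4 because i⁴ = 1: every summand of the symbol is then nonnegative and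
no cancellation can occur. -/
lemma mFourierCoeff_torusElliptic (hu : TorusAnalyticOn u A) (N : ℕ) {x : X}
    (hx : x ∈ A) (m : Fin l → ℤ) :
    mFourierCoeff (fun θ => ((torusElliptic N u (θ, x) : ℝ) : ℂ)) m =
      ellipticSymbol N m * mFourierCoeff (fun θ => ((u (θ, x) : ℝ) : ℂ)) m := by
  have h1 : mFourierCoeff (fun θ => ((torusElliptic N u (θ, x) : ℝ) : ℂ)) m =
      ∑ i, mFourierCoeff (fun θ => (((torusDeriv i)^[4 * N] u (θ, x) : ℝ) : ℂ)) m := by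
    have hint : ∀ i ∈ Finset.univ, Integrable (fun θ => mFourier (-m) θ •
        (((torusDeriv i)^[4 * N] u (θ, x) : ℝ) : ℂ)) (torusHaar l) := fun i _ =>
      integrable_torusHaar_of_continuous ((mFourier (-m)).continuous.smul
        (Complex.continuous_ofReal.comp ((hu.torusDeriv_iterate i (4 * N)).continuous_angle hx)))
    have := integral_finsetSum Finset.univ hint
    refine Eq.trans ?_ this
    rw [mFourierCoeff]
    simp only [torusElliptic, Complex.ofReal_sum, Finset.smul_sum]
    rfl
  rw [h1, ellipticSymbol, Complex.ofReal_sum, Finset.sum_mul]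
  refine Finset.sum_congr rfl fun i _ => ?_
  rw [mFourierCoeff_torusDeriv_iterate hu i _ hx]
  congr 1
  push_cast
  rw [show (2 * Real.pi * Complex.I * m i : ℂ) = Complex.I * (2 * Real.pi * m i) by ring, mul_pow,
    pow_mul Complex.I, Complex.I_pow_four, one_pow, one_mul]

/-- The summand of a largest component of `m` suffices, as 2π ≥ 1 and the others are nonnegative. -/
lemma norm_pow_le_ellipticSymbol (N : ℕ) {m : Fin l → ℤ} (hm : m ≠ 0) :
    ‖m‖ ^ (4 * N) ≤ ellipticSymbol N m := by
  have he : ∀ i, 0 ≤ (2 * Real.pi * (m i : ℝ)) ^ (4 * N) := fun i =>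
    (show Even (4 * N) from ⟨2 * N, by ring⟩).pow_nonneg _
  have : Nonempty (Fin l) := by
    obtain ⟨i, _⟩ := Function.ne_iff.1 hm
    exact ⟨i⟩
  obtain ⟨i, hi⟩ := Finite.exists_max fun i => ‖m i‖
  have h1 : ‖m‖ ≤ ‖m i‖ := (pi_norm_le_iff_of_nonneg (norm_nonneg _)).2 hi
  refine le_trans ?_ (Finset.single_le_sum (f := fun i => (2 * Real.pi * (m i : ℝ)) ^ (4 * N))
    (fun i _ => he i) (Finset.mem_univ i))
  have h2 : ‖m i‖ ≤ |2 * Real.pi * (m i : ℝ)| := by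
    rw [abs_mul, Int.norm_eq_abs]
    refine le_mul_of_one_le_left (abs_nonneg _) ?_
    rw [abs_of_pos (by positivity)]
    linarith [Real.pi_gt_three]
  calc ‖m‖ ^ (4 * N) ≤ |2 * Real.pi * (m i : ℝ)| ^ (4 * N) := by gcongr; exact h1.trans h2
    _ = _ := (show Even (4 * N) from ⟨2 * N, by ring⟩).pow_abs _

/-- The Fourier coefficients of the kernel that inverts the composition of the difference operator
`u ↦ u(· + ω) - u` with `torusElliptic`. -/
noncomputable def homologicalCoeff (N : ℕ) (ω : Fin l → ℝ) (m : Fin l → ℤ) : ℂ :=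
  if m = 0 then 0 else (ellipticSymbol N m * (mFourier m (torusMk ω) - 1) : ℂ)⁻¹

/-- The symbol gains ‖m‖^(4N) and the small divisor loses ‖m‖^μ; the resulting exponent μ − 4N lies
below −l. -/
lemma summable_homologicalCoeff {c μ : ℝ} (hc : 0 < c) {ω : Fin l → ℝ}
    (hω : ω ∈ diophantine l c μ) {N : ℕ} (hN : μ + l < 4 * N) :
    Summable (homologicalCoeff N ω) := by
  refine Summable.of_norm_bounded
    ((summable_norm_rpow_int l (r := μ - (4 * N : ℕ)) (by push_cast; linarith)).mul_left
      (4 * c)⁻¹) fun m => ?_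
  by_cases hm : m = 0
  · simp only [homologicalCoeff, hm, if_true, norm_zero]; positivity
  · have hm' : 0 < ‖m‖ := norm_pos_iff.2 hm
    rw [homologicalCoeff, if_neg hm, norm_inv, norm_mul]
    have h1 := norm_pow_le_ellipticSymbol N hm
    have h2 := le_norm_mFourier_sub_one hω hm
    have h3 : ‖(ellipticSymbol N m : ℂ)‖ = ellipticSymbol N m := by
      rw [Complex.norm_real, Real.norm_of_nonneg ((by positivity : (0:ℝ) ≤ _).trans h1)]
    have h4 : (4 * c)⁻¹ * ‖m‖ ^ (μ - (4 * N : ℕ)) =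
        (‖m‖ ^ (4 * N) * (4 * (c * ‖m‖ ^ (-μ))))⁻¹ := by
      rw [Real.rpow_sub hm', Real.rpow_neg hm'.le, Real.rpow_natCast]
      field_simp
    rw [h3, h4]
    gcongr
    exact (by positivity : (0 : ℝ) ≤ _).trans h1

lemma mFourier_torusMk_ne_one {c μ : ℝ} (hc : 0 < c) {ω : Fin l → ℝ}
    (hω : ω ∈ diophantine l c μ) {m : Fin l → ℤ} (hm : m ≠ 0) :
    mFourier m (torusMk ω) - 1 ≠ 0 := by
  have hm' : 0 < ‖m‖ := norm_pos_iff.2 hm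
  exact norm_pos_iff.1 (lt_of_lt_of_le (by positivity) (le_norm_mFourier_sub_one hω hm))

/-- The solution of the homological equation, a convolution with a continuous kernel. -/
noncomputable def homologicalSolution (N : ℕ) (ω : Fin l → ℝ)
    (u : UnitAddTorus (Fin l) × X → ℝ) (q : UnitAddTorus (Fin l) × X) : ℝ :=
  ∫ φ, (∑' m, homologicalCoeff N ω m * mFourier m φ).re * torusElliptic N u (q.1 - φ, q.2)
    ∂torusHaar l

/-- The kernel depends on the integration variable alone, so it is only a bounded measurable weight;
the angle and the parameter enter through the analytic function `torusElliptic N u`. -/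
lemma TorusAnalyticOn.homologicalSolution (hu : TorusAnalyticOn u A) {c μ : ℝ} (hc : 0 < c)
    {ω : Fin l → ℝ} (hω : ω ∈ diophantine l c μ) {N : ℕ} (hN : μ + l < 4 * N) :
    TorusAnalyticOn (homologicalSolution N ω u) A := by
  rintro ⟨p, x⟩ ⟨-, hx⟩
  have hsum := summable_homologicalCoeff hc hω hN
  have hcont := continuous_tsum_mFourier hsum
  have hK : IsCompact (Icc (0 : Fin l → ℝ) 1) := isCompact_Icc
  have hfin : IsFiniteMeasure ((volume : Measure (Fin l → ℝ)).restrict (Icc 0 1)) :=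
    ⟨by rw [Measure.restrict_apply_univ]; exact hK.measure_lt_top⟩
  have hmeas : MeasurableSet {x : Fin l → ℝ | ∀ i, x i ∈ Ioc 0 1} := by
    have := MeasurableSet.univ_pi (t := fun _ : Fin l => Ioc (0 : ℝ) 1) fun _ => measurableSet_Ioc
    simpa [Set.pi] using this
  have hsub : {x : Fin l → ℝ | ∀ i, x i ∈ Ioc 0 1} ⊆ Icc (0 : Fin l → ℝ) 1 := fun x hx =>
    ⟨fun i => (hx i).1.le, fun i => (hx i).2⟩
  -- The torus is unfolded to the half-open unit cube, which lies in the compact closed cube.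
  have h := analyticAt_setIntegral_of_isCompact (E₁ := Fin l → ℝ) (E₂ := (Fin l → ℝ) × X)
    (g := fun z => _root_.torusElliptic N u (torusMk (z.2.1 - z.1), z.2.2)) hK (x₀ := (p, x))
    (fun y _ => AnalyticAt.comp (f := fun z : (Fin l → ℝ) × ((Fin l → ℝ) × X) =>
        (z.2.1 - z.1, z.2.2)) (x := (y, (p, x)))
      (hu.torusElliptic N (p - y, x) ⟨mem_univ _, hx⟩)
      ((((ContinuousLinearMap.fst ℝ (Fin l → ℝ) X).comp
          (ContinuousLinearMap.snd ℝ (Fin l → ℝ) ((Fin l → ℝ) × X)) -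
        ContinuousLinearMap.fst ℝ (Fin l → ℝ) ((Fin l → ℝ) × X)).prod
        ((ContinuousLinearMap.snd ℝ (Fin l → ℝ) X).comp
          (ContinuousLinearMap.snd ℝ (Fin l → ℝ) ((Fin l → ℝ) × X)))).analyticAt _))
    ((volume : Measure (Fin l → ℝ)).restrict (Icc 0 1))
    (k := fun y => (∑' m, homologicalCoeff N ω m * mFourier m (torusMk y)).re)
    (Complex.continuous_re.comp (hcont.comp continuous_torusMk)).measurable
    (B := ∑' m, ‖homologicalCoeff N ω m‖) (fun y => (Complex.abs_re_le_norm _).trans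
      (tsum_of_norm_bounded hsum.norm.hasSum fun m => by
        rw [norm_mul, norm_mFourier_apply, mul_one])) hmeas hsub
  convert h using 2 with q
  rw [_root_.homologicalSolution, integral_torusHaar_eq, Measure.restrict_restrict hmeas,
    inter_eq_left.2 hsub]
  simp only [torusMk_sub, smul_eq_mul]

/-- Since `torusElliptic N u` is real, taking the real part of the kernel amounts to taking the real
part of the complex convolution. -/
lemma homologicalSolution_hasSum (hu : TorusAnalyticOn u A) {c μ : ℝ} (hc : 0 < c)
    {ω : Fin l → ℝ} (hω : ω ∈ diophantine l c μ) {N : ℕ} (hN : μ + l < 4 * N) {x : X}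
    (hx : x ∈ A) (ψ : UnitAddTorus (Fin l)) :
    HasSum (fun m => (homologicalCoeff N ω m * mFourier m ψ *
      (ellipticSymbol N m * mFourierCoeff (fun θ => ((u (θ, x) : ℝ) : ℂ)) m)).re)
      (homologicalSolution N ω u (ψ, x)) := by
  have hsum := summable_homologicalCoeff hc hω hN
  have hcont := continuous_tsum_mFourier hsum
  have hv := (hu.torusElliptic N).continuous_angle hx
  have h := hasSum_mFourier_convolution hsum (Complex.continuous_ofReal.comp hv) ψ
  have h2 := Complex.hasSum_re h
  have h3 : (∫ φ, (∑' m, homologicalCoeff N ω m * mFourier m φ) *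
      ((torusElliptic N u (ψ - φ, x) : ℝ) : ℂ) ∂torusHaar l).re =
      homologicalSolution N ω u (ψ, x) := by
    have hint : Integrable (fun φ => (∑' m, homologicalCoeff N ω m * mFourier m φ) *
        ((torusElliptic N u (ψ - φ, x) : ℝ) : ℂ)) (torusHaar l) :=
      integrable_torusHaar_of_continuous (hcont.mul (Complex.continuous_ofReal.comp
        (hv.comp (continuous_const.sub continuous_id))))
    have := integral_re (𝕜 := ℂ) hint
    simp only [RCLike.re_eq_complex_re] at this
    rw [← this, homologicalSolution]
    simp only [Complex.re_mul_ofReal]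
  simp only [Function.comp_def] at h2
  rw [h3] at h2
  simpa only [mFourierCoeff_torusElliptic hu N hx] using h2

/-- The homological equation `T(θ + ω) - T(θ) = u(θ) - ∫ u` over a Diophantine rotation has an
analytic solution that depends analytically on parameters. -/
theorem exists_homologicalSolution (hu : TorusAnalyticOn u A) {c μ : ℝ} (hc : 0 < c)
    {ω : Fin l → ℝ} (hω : ω ∈ diophantine l c μ) :
    ∃ T : UnitAddTorus (Fin l) × X → ℝ, TorusAnalyticOn T A ∧
      ∀ θ, ∀ x ∈ A, T (θ + torusMk ω, x) - T (θ, x) =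
        u (θ, x) - ∫ φ, u (φ, x) ∂torusHaar l := by
  obtain ⟨N, hN⟩ := exists_nat_gt (μ + l)
  have hN' : μ + l < 4 * N := hN.trans_le (by linarith [(Nat.cast_nonneg N : (0 : ℝ) ≤ N)])
  refine ⟨homologicalSolution N ω u, hu.homologicalSolution hc hω hN', fun θ x hx => ?_⟩
  have hcontu := hu.continuous_angle hx
  set f : C(UnitAddTorus (Fin l), ℂ) :=
    ⟨fun θ => ((u (θ, x) : ℝ) : ℂ), Complex.continuous_ofReal.comp hcontu⟩ with hf
  have h1 := (homologicalSolution_hasSum hu hc hω hN' hx (θ + torusMk ω)).sub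
    (homologicalSolution_hasSum hu hc hω hN' hx θ)
  have hne : ∀ m : Fin l → ℤ, m ≠ 0 → (ellipticSymbol N m : ℂ) ≠ 0 := fun m hm => by
    have hm' : 0 < ‖m‖ := norm_pos_iff.2 hm
    exact_mod_cast ((by positivity : (0 : ℝ) < _).trans_le (norm_pow_le_ellipticSymbol N hm)).ne'
  -- The nonzero coefficients are `homologicalCoeff` times a bounded factor, because symbol times
  -- coefficient is a Fourier coefficient of the continuous function `torusElliptic N u`.
  have hsum : Summable (mFourierCoeff f) := by
    have hb : ∃ C, ∀ m, ‖(ellipticSymbol N m : ℂ) * (mFourier m (torusMk ω) - 1) *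
        mFourierCoeff f m‖ ≤ C := by
      obtain ⟨C, hC⟩ := isCompact_univ.exists_bound_of_continuousOn
        ((hu.torusElliptic N).continuous_angle hx).continuousOn
      refine ⟨2 * C, fun m => ?_⟩
      rw [mul_right_comm, mul_comm, norm_mul]
      have h2 : ‖mFourier m (torusMk ω) - 1‖ ≤ 2 := by
        refine (norm_sub_le _ _).trans ?_
        rw [norm_mFourier_apply]
        norm_num
      refine mul_le_mul h2 ?_ (norm_nonneg _) (by norm_num)
      have h3 := mFourierCoeff_torusElliptic hu N hx m
      change _ = _ * mFourierCoeff f m at h3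
      rw [← h3, mFourierCoeff_eq_integral_torusHaar]
      have h4 := norm_integral_le_of_norm_le_const (μ := torusHaar l)
        (f := fun θ => mFourier (-m) θ • ((torusElliptic N u (θ, x) : ℝ) : ℂ)) (C := C)
        (Filter.Eventually.of_forall fun θ => by
          rw [norm_smul, norm_mFourier_apply, one_mul, Complex.norm_real]
          exact hC θ (mem_univ _))
      simpa using h4
    obtain ⟨C, hC⟩ := hb
    have hs := (summable_homologicalCoeff hc hω hN').norm.mul_right C
    refine Summable.of_norm_bounded_eventually hs ?_
    filter_upwards [(Set.finite_singleton (0 : Fin l → ℤ)).compl_mem_cofinite] with m hm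
    have hm : m ≠ 0 := hm
    have h5 : mFourierCoeff f m = homologicalCoeff N ω m *
        ((ellipticSymbol N m : ℂ) * (mFourier m (torusMk ω) - 1) * mFourierCoeff f m) := by
      have h6 := mFourier_torusMk_ne_one hc hω hm
      have h7 := hne m hm
      rw [homologicalCoeff, if_neg hm]
      field_simp
    rw [h5, norm_mul]
    gcongr
    exact hC m
  -- Replacing the zero mode by 0 subtracts the mean from the Fourier series.
  have h8 := Complex.hasSum_re ((hasSum_mFourier_series_apply_of_summable hsum θ).update 0 0)
  have h9 := h1.unique (h8.congr_fun ?_)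
  · rw [h9]
    have : mFourierCoeff f 0 = ((∫ φ, u (φ, x) ∂torusHaar l : ℝ) : ℂ) := by
      rw [mFourierCoeff_eq_integral_torusHaar, ← integral_complex_ofReal]
      simp [mFourier_zero, hf]
    rw [this]
    simp [mFourier_zero, hf]
    ring
  · intro m
    by_cases hm : m = 0
    · subst hm; simp [homologicalCoeff]
    · rw [Function.update_of_ne hm, ← Complex.sub_re]
      congr 1
      have h6 := mFourier_torusMk_ne_one hc hω hm
      have h7 := hne m hm
      rw [mFourier_apply_add, homologicalCoeff, if_neg hm, smul_eq_mul]
      change _ * (_ * mFourierCoeff f m) - _ * (_ * mFourierCoeff f m) = _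
      field_simp

end HomologicalEquation

/-! ### Vector-valued homological equation and division by a parameter. -/

section AnalyticTools

variable {l : ℕ}

theorem exists_homologicalSolution_pi {d : ℕ} {X : Type*} [NormedAddCommGroup X] [NormedSpace ℝ X]
    {u : UnitAddTorus (Fin l) × X → (Fin d → ℝ)} {A : Set X}
    (hu : TorusAnalyticOn u A) {c μ : ℝ} (hc : 0 < c) {ω : Fin l → ℝ}
    (hω : ω ∈ diophantine l c μ) :
    ∃ T : UnitAddTorus (Fin l) × X → (Fin d → ℝ), TorusAnalyticOn T A ∧
      ∀ θ, ∀ x ∈ A, T (θ + torusMk ω, x) - T (θ, x) = u (θ, x) - ∫ φ, u (φ, x) := by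
  have hui : ∀ i, TorusAnalyticOn (fun q => u q i) A := fun i p hp =>
    ((ContinuousLinearMap.proj (R := ℝ) (φ := fun _ : Fin d => ℝ) i).analyticAt _).comp (hu p hp)
  choose T hT hTu using fun i => exists_homologicalSolution (hui i) hc hω
  refine ⟨fun q i => T i q, fun p hp => analyticAt_pi_iff.2 fun i => hT i p hp, fun θ x hx => ?_⟩
  ext i
  have h := hTu i θ x hx
  simp only [Pi.sub_apply, h]
  rw [volume_eq_torusHaar, eval_integral]
  intro i
  exact integrable_torusHaar_of_continuous ((hui i).continuous_angle hx)

variable {Y E : Type*} [NormedAddCommGroup Y] [NormedSpace ℝ Y] [NormedAddCommGroup E]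
  [NormedSpace ℝ E]

lemma hasDerivAt_lift_parameter {g : UnitAddTorus (Fin l) × (Y × ℝ) → E} {p : Fin l → ℝ} {y : Y}
    {s : ℝ} (hg : AnalyticAt ℝ (fun z : (Fin l → ℝ) × (Y × ℝ) => g (torusMk z.1, z.2)) (p, (y, s))) :
    HasDerivAt (fun s => g (torusMk p, (y, s)))
      (fderiv ℝ (fun z : (Fin l → ℝ) × (Y × ℝ) => g (torusMk z.1, z.2)) (p, (y, s)) (0, (0, 1)))
      s := by
  have h1 : HasDerivAt (fun s : ℝ => ((p, (y, s)) : (Fin l → ℝ) × (Y × ℝ))) (0, (0, 1)) s :=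
    (hasDerivAt_const _ _).prodMk ((hasDerivAt_const _ _).prodMk (hasDerivAt_id _))
  exact HasFDerivAt.comp_hasDerivAt s hg.differentiableAt.hasFDerivAt h1

lemma TorusAnalyticOn.deriv_parameter [CompleteSpace E] {g : UnitAddTorus (Fin l) × (Y × ℝ) → E}
    {A : Set (Y × ℝ)} (hg : TorusAnalyticOn g A) :
    TorusAnalyticOn (fun z => deriv (fun s => g (z.1, (z.2.1, s))) z.2.2) A := by
  rintro ⟨p, y, s⟩ hx
  have h := hg (p, (y, s)) hx
  have h1 : AnalyticAt ℝ (fun q => fderiv ℝ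
      (fun z : (Fin l → ℝ) × (Y × ℝ) => g (torusMk z.1, z.2)) q (0, (0, 1))) (p, (y, s)) :=
    ((ContinuousLinearMap.apply ℝ E ((0, (0, 1)) : (Fin l → ℝ) × (Y × ℝ))).analyticAt _).comp
      h.fderiv
  refine h1.congr ?_
  filter_upwards [h.eventually_analyticAt] with q hq
  exact (hasDerivAt_lift_parameter (s := q.2.2) hq).deriv.symm

/-- An analytic function that vanishes for the value `0` of a parameter is divisible by the
parameter. -/
theorem TorusAnalyticOn.exists_eq_smul [CompleteSpace E] {g : UnitAddTorus (Fin l) × (Y × ℝ) → E}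
    {A : Set Y} {b : ℝ} (hg : TorusAnalyticOn g (A ×ˢ Ioo (-b) b))
    (h0 : ∀ θ, ∀ y ∈ A, g (θ, (y, 0)) = 0) :
    ∃ q : UnitAddTorus (Fin l) × (Y × ℝ) → E, TorusAnalyticOn q (A ×ˢ Ioo (-b) b) ∧
      ∀ θ, ∀ y ∈ A, ∀ s ∈ Ioo (-b) b, g (θ, (y, s)) = s • q (θ, (y, s)) := by
  have hD := hg.deriv_parameter
  set D : UnitAddTorus (Fin l) × (Y × ℝ) → E :=
    fun z => deriv (fun s => g (z.1, (z.2.1, s))) z.2.2 with hDdef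
  have hts : ∀ t ∈ Icc (0 : ℝ) 1, ∀ s ∈ Ioo (-b) b, t * s ∈ Ioo (-b) b := by
    intro t ht s hs
    rw [mem_Ioo, ← abs_lt] at hs ⊢
    rw [abs_mul, abs_of_nonneg ht.1]
    exact (mul_le_of_le_one_left (abs_nonneg s) ht.2).trans_lt hs
  -- Hadamard's formula: the quotient is ∫₀¹ ∂_s g(θ, y, ts) dt, also at s = 0.
  refine ⟨fun z => ∫ t in Ioc (0 : ℝ) 1, D (z.1, (z.2.1, t * z.2.2)), ?_, ?_⟩
  · rintro ⟨p, y, s⟩ ⟨-, hy, hs⟩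
    have hfin : IsFiniteMeasure ((volume : Measure ℝ).restrict (Icc 0 1)) :=
      ⟨by rw [Measure.restrict_apply_univ]; exact isCompact_Icc.measure_lt_top⟩
    have hmap : ∀ t : ℝ, AnalyticAt ℝ (fun z : ℝ × ((Fin l → ℝ) × (Y × ℝ)) =>
        ((z.2.1, (z.2.2.1, z.1 * z.2.2.2)) : (Fin l → ℝ) × (Y × ℝ))) (t, (p, (y, s))) := by
      intro t
      have a2 : AnalyticAt ℝ (fun z : ℝ × ((Fin l → ℝ) × (Y × ℝ)) => z.2) (t, (p, (y, s))) :=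
        analyticAt_snd
      have a22 : AnalyticAt ℝ (fun z : ℝ × ((Fin l → ℝ) × (Y × ℝ)) => z.2.2) (t, (p, (y, s))) :=
        analyticAt_snd.comp a2
      exact (analyticAt_fst.comp a2).prod ((analyticAt_fst.comp a22).prod
        (analyticAt_fst.mul (analyticAt_snd.comp a22)))
    have h := analyticAt_setIntegral_of_isCompact (E₁ := ℝ) (E₂ := (Fin l → ℝ) × (Y × ℝ))
      (g := fun z => D (torusMk z.2.1, (z.2.2.1, z.1 * z.2.2.2))) (isCompact_Icc (a := 0) (b := 1))
      (x₀ := (p, (y, s)))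
      (fun t ht => AnalyticAt.comp (f := fun z : ℝ × ((Fin l → ℝ) × (Y × ℝ)) =>
          ((z.2.1, (z.2.2.1, z.1 * z.2.2.2)) : (Fin l → ℝ) × (Y × ℝ))) (x := (t, (p, (y, s))))
        (hD (p, (y, t * s)) ⟨mem_univ _, hy, hts t ht s hs⟩) (hmap t))
      ((volume : Measure ℝ).restrict (Icc 0 1)) (k := fun _ => 1) measurable_const (B := 1)
      (fun _ => by simp) measurableSet_Ioc Ioc_subset_Icc_self
    convert h using 2 with q
    rw [Measure.restrict_restrict measurableSet_Ioc, inter_eq_left.2 Ioc_subset_Icc_self]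
    simp only [one_smul]
  · intro θ y hy s hs
    obtain ⟨p, rfl⟩ := torusMk_surjective θ
    have hder : ∀ t ∈ Icc (0 : ℝ) 1, HasDerivAt (fun t => g (torusMk p, (y, t * s)))
        (s • D (torusMk p, (y, t * s))) t := by
      intro t ht
      have h1 := hasDerivAt_lift_parameter (hg (p, (y, t * s)) ⟨mem_univ _, hy, hts t ht s hs⟩)
      have h2 := h1.differentiableAt.hasDerivAt.scomp t ((hasDerivAt_id t).mul_const s)
      simpa [Function.comp_def, hDdef] using h2
    have hcont : ContinuousOn (fun t => s • D (torusMk p, (y, t * s))) (Icc 0 1) := by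
      intro t ht
      have h3 : ContinuousAt (fun t : ℝ => D (torusMk p, (y, t * s))) t :=
        ContinuousAt.comp (f := fun t : ℝ => ((p, (y, t * s)) : (Fin l → ℝ) × (Y × ℝ)))
          (hD (p, (y, t * s)) ⟨mem_univ _, hy, hts t ht s hs⟩).continuousAt (by fun_prop)
      exact (h3.const_smul s).continuousWithinAt
    have h4 := intervalIntegral.integral_eq_sub_of_hasDerivAt (a := 0) (b := 1)
      (by simpa [uIcc_of_le zero_le_one] using hder)
      (ContinuousOn.intervalIntegrable (by simpa [uIcc_of_le zero_le_one] using hcont))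
    rw [intervalIntegral.integral_of_le zero_le_one, integral_smul] at h4
    simp only [one_mul, zero_mul, h0 _ y hy, sub_zero] at h4
    exact h4.symm

end AnalyticTools

/-! ### The near-identity transformation for small parameters. -/

section NearIdentity

variable {l j : ℕ}

/-- The lifted phase space together with the parameter. -/
abbrev LiftedPhase (l j : ℕ) : Type := (Fin l → ℝ) × ((Fin j → ℝ) × ℝ)

/-- The covering map of the phase space, with the parameter as a first component. -/
def paramMk (z : LiftedPhase l j) : ℝ × Phase l j := (z.2.2, (torusMk z.1, z.2.1))

/-- The near-identity transformation `(ψ, I) ↦ (ψ + κ^n T(ψ, I), I + κ^n S(ψ, I))`. -/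
noncomputable def nearId (n : ℕ) (T : Phase l j → (Fin l → ℝ)) (S : Phase l j → (Fin j → ℝ))
    (κ : ℝ) (x : Phase l j) : Phase l j :=
  (x.1 + torusMk (κ ^ n • T x), x.2 + κ ^ n • S x)

/-- The lift of the near-identity transformation to the covering space, with the parameter. -/
noncomputable def nearIdLift (n : ℕ) (T : Phase l j → (Fin l → ℝ)) (S : Phase l j → (Fin j → ℝ))
    (z : LiftedPhase l j) : LiftedPhase l j :=
  (z.1 + z.2.2 ^ n • T (torusMk z.1, z.2.1),
    (z.2.1 + z.2.2 ^ n • S (torusMk z.1, z.2.1), z.2.2))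

lemma continuous_paramMk : Continuous (paramMk : LiftedPhase l j → _) := by
  have := continuous_torusMk (l := l)
  unfold paramMk
  fun_prop

lemma isOpenMap_paramMk : IsOpenMap (paramMk : LiftedPhase l j → _) := by
  have h1 : IsOpenMap (fun z : LiftedPhase l j => (z.2.2, (z.1, z.2.1))) :=
    ((Homeomorph.prodAssoc _ _ _).symm.trans (Homeomorph.prodComm _ _)).isOpenMap
  exact (IsOpenMap.id.prodMap (isOpenMap_torusMk.prodMap IsOpenMap.id)).comp h1

lemma paramMk_surjective : Function.Surjective (paramMk : LiftedPhase l j → _) := by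
  rintro ⟨κ, θ, J⟩
  obtain ⟨p, rfl⟩ := torusMk_surjective θ
  exact ⟨(p, (J, κ)), rfl⟩

/-- Transfers statements valid near a point of the phase space to statements near a lift of it. -/
lemma map_paramMk_nhds (z : LiftedPhase l j) : Filter.map paramMk (𝓝 z) = 𝓝 (paramMk z) :=
  isOpenMap_paramMk.map_nhds_eq continuous_paramMk.continuousAt

lemma paramMk_nearIdLift (n : ℕ) (T : Phase l j → (Fin l → ℝ)) (S : Phase l j → (Fin j → ℝ))
    (z : LiftedPhase l j) :
    paramMk (nearIdLift n T S z) = ((paramMk z).1, nearId n T S (paramMk z).1 (paramMk z).2) := by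
  simp [paramMk, nearIdLift, nearId, torusMk_add]

variable {n : ℕ} {T : Phase l j → (Fin l → ℝ)} {S : Phase l j → (Fin j → ℝ)}
  {M : Set (Fin j → ℝ)}

lemma TorusAnalyticOn.analyticAt_comp_lift {E : Type*} [NormedAddCommGroup E] [NormedSpace ℝ E]
    {T : Phase l j → E} (hT : TorusAnalyticOn T M) {z : LiftedPhase l j} (hz : z.2.1 ∈ M) :
    AnalyticAt ℝ (fun z : LiftedPhase l j => T (torusMk z.1, z.2.1)) z :=
  AnalyticAt.comp (f := fun z : LiftedPhase l j => (z.1, z.2.1)) (x := z)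
    (hT (z.1, z.2.1) ⟨mem_univ _, hz⟩)
    (((ContinuousLinearMap.fst ℝ (Fin l → ℝ) ((Fin j → ℝ) × ℝ)).prod
      ((ContinuousLinearMap.fst ℝ (Fin j → ℝ) ℝ).comp
        (ContinuousLinearMap.snd ℝ (Fin l → ℝ) ((Fin j → ℝ) × ℝ)))).analyticAt _)

lemma analyticAt_liftParam (z : LiftedPhase l j) :
    AnalyticAt ℝ (fun z : LiftedPhase l j => z.2.2) z :=
  ((ContinuousLinearMap.snd ℝ (Fin j → ℝ) ℝ).comp
    (ContinuousLinearMap.snd ℝ (Fin l → ℝ) ((Fin j → ℝ) × ℝ))).analyticAt _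

lemma analyticAt_liftSlow (z : LiftedPhase l j) :
    AnalyticAt ℝ (fun z : LiftedPhase l j => z.2.1) z :=
  ((ContinuousLinearMap.fst ℝ (Fin j → ℝ) ℝ).comp
    (ContinuousLinearMap.snd ℝ (Fin l → ℝ) ((Fin j → ℝ) × ℝ))).analyticAt _

lemma analyticAt_nearIdLift (hT : TorusAnalyticOn T M) (hS : TorusAnalyticOn S M)
    {z : LiftedPhase l j} (hz : z.2.1 ∈ M) : AnalyticAt ℝ (nearIdLift n T S) z := by
  have hk := (analyticAt_liftParam z).pow n
  exact (analyticAt_fst.add (hk.smul (hT.analyticAt_comp_lift hz))).prod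
    (((analyticAt_liftSlow z).add (hk.smul (hS.analyticAt_comp_lift hz))).prod
      (analyticAt_liftParam z))

/-- The shear `v ↦ v + π(v) c` along a vector `c` with `π(c) = 0`. -/
noncomputable def shearEquiv {E : Type*} [NormedAddCommGroup E] [NormedSpace ℝ E] (π : E →L[ℝ] ℝ)
    (c : E) (hc : π c = 0) : E ≃L[ℝ] E :=
  ContinuousLinearEquiv.equivOfInverse
    (ContinuousLinearMap.id ℝ E + π.smulRight c) (ContinuousLinearMap.id ℝ E - π.smulRight c)
    (fun v => by simp [hc]) (fun v => by simp [hc])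

/-- As n ≥ 1, the lift has the form z + π(z)R(z) with π the parameter coordinate. Where π(z) = 0 its
derivative is v ↦ v + π(v)R(z), and π(R(z)) = 0 because the parameter is left fixed. -/
lemma hasFDerivAt_nearIdLift (hn : 1 ≤ n) (hT : TorusAnalyticOn T M) (hS : TorusAnalyticOn S M)
    {z : LiftedPhase l j} (hz : z.2.1 ∈ M) (hz0 : z.2.2 = 0) :
    ∃ e : LiftedPhase l j ≃L[ℝ] LiftedPhase l j,
      HasFDerivAt (nearIdLift n T S) (e : LiftedPhase l j →L[ℝ] LiftedPhase l j) z := by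
  obtain ⟨k, rfl⟩ : ∃ k, n = k + 1 := ⟨n - 1, by omega⟩
  set π : LiftedPhase l j →L[ℝ] ℝ := (ContinuousLinearMap.snd ℝ (Fin j → ℝ) ℝ).comp
    (ContinuousLinearMap.snd ℝ (Fin l → ℝ) ((Fin j → ℝ) × ℝ)) with hπ
  set R : LiftedPhase l j → LiftedPhase l j := fun z => z.2.2 ^ k •
    (T (torusMk z.1, z.2.1), (S (torusMk z.1, z.2.1), (0 : ℝ))) with hR
  have hRa : AnalyticAt ℝ R z := ((analyticAt_liftParam z).pow k).smul
    ((hT.analyticAt_comp_lift hz).prod ((hS.analyticAt_comp_lift hz).prod analyticAt_const))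
  have h1 : HasFDerivAt (fun z => z + π z • R z)
      (ContinuousLinearMap.id ℝ _ + (π z • fderiv ℝ R z + π.smulRight (R z))) z :=
    (hasFDerivAt_id z).add (π.hasFDerivAt.smul hRa.differentiableAt.hasFDerivAt)
  have h2 : π z = 0 := hz0
  refine ⟨shearEquiv π (R z) (by simp [hπ, hR]), ?_⟩
  rw [h2, zero_smul, zero_add] at h1
  refine h1.congr_of_eventuallyEq (Filter.Eventually.of_forall fun w => ?_)
  simp only [nearIdLift, hπ, hR, pow_succ']
  ext <;> simp [mul_assoc]

lemma nearIdLift_of_param_eq_zero (hn : 1 ≤ n) {z : LiftedPhase l j} (hz0 : z.2.2 = 0) :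
    nearIdLift n T S z = z := by
  have : n ≠ 0 := by omega
  obtain ⟨p, I, κ⟩ := z
  obtain rfl : κ = 0 := hz0
  simp [nearIdLift, this]

/-- At the parameter value `0` the lifted transformation is a local analytic diffeomorphism. -/
lemma exists_openPartialHomeomorph_nearIdLift (hn : 1 ≤ n) (hT : TorusAnalyticOn T M)
    (hS : TorusAnalyticOn S M) {z : LiftedPhase l j} (hz : z.2.1 ∈ M) (hz0 : z.2.2 = 0) :
    ∃ e : OpenPartialHomeomorph (LiftedPhase l j) (LiftedPhase l j),
      (e : LiftedPhase l j → LiftedPhase l j) = nearIdLift n T S ∧ z ∈ e.source ∧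
      AnalyticAt ℝ e.symm z := by
  obtain ⟨e', he'⟩ := hasFDerivAt_nearIdLift hn hT hS hz hz0
  have ha := analyticAt_nearIdLift (n := n) hT hS hz
  have hs : HasStrictFDerivAt (nearIdLift n T S) (e' : LiftedPhase l j →L[ℝ] LiftedPhase l j) z := by
    have := ha.hasStrictFDerivAt
    rwa [he'.fderiv] at this
  refine ⟨hs.toOpenPartialHomeomorph _, hs.toOpenPartialHomeomorph_coe,
    hs.mem_toOpenPartialHomeomorph_source, ?_⟩
  have := (hs.toOpenPartialHomeomorph _).analyticAt_symm' (i := e')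
    hs.mem_toOpenPartialHomeomorph_source (by simpa using ha) (by simpa using he'.fderiv)
  rwa [hs.toOpenPartialHomeomorph_coe, nearIdLift_of_param_eq_zero hn hz0] at this

/-- The transformation has an analytic local inverse, jointly in the parameter, at the image of some
lift of `x`. -/
def HasAnalyticLocalInverse (n : ℕ) (T : Phase l j → (Fin l → ℝ)) (S : Phase l j → (Fin j → ℝ))
    (x : ℝ × Phase l j) : Prop :=
  ∃ (z : LiftedPhase l j) (g : LiftedPhase l j → LiftedPhase l j), paramMk z = x ∧
    AnalyticAt ℝ g (nearIdLift n T S z) ∧ g (nearIdLift n T S z) = z ∧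
    ∀ᶠ w in 𝓝 (nearIdLift n T S z), nearIdLift n T S (g w) = w

lemma eventually_hasAnalyticLocalInverse (hn : 1 ≤ n) (hT : TorusAnalyticOn T M)
    (hS : TorusAnalyticOn S M) {x : Phase l j} (hx : x.2 ∈ M) :
    ∀ᶠ y in 𝓝 ((0 : ℝ), x), HasAnalyticLocalInverse n T S y := by
  obtain ⟨z, hz⟩ := paramMk_surjective ((0 : ℝ), x)
  have hz0 : z.2.2 = 0 := congrArg Prod.fst hz
  have hzM : z.2.1 ∈ M := by
    have : z.2.1 = x.2 := congrArg (fun y => y.2.2) hz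
    rwa [this]
  obtain ⟨e, he, hze, hea⟩ := exists_openPartialHomeomorph_nearIdLift hn hT hS hzM hz0
  have hezz : e z = z := by rw [he, nearIdLift_of_param_eq_zero hn hz0]
  rw [← hz, ← map_paramMk_nhds, Filter.eventually_map]
  have h1 : ∀ᶠ w in 𝓝 z, AnalyticAt ℝ e.symm (e w) := by
    have := e.continuousAt hze
    rw [ContinuousAt, hezz] at this
    exact this.eventually hea.eventually_analyticAt
  filter_upwards [h1, e.open_source.mem_nhds hze] with w hw hwe
  unfold HasAnalyticLocalInverse
  rw [← he]
  refine ⟨w, e.symm, rfl, hw, e.left_inv hwe, ?_⟩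
  filter_upwards [e.open_target.mem_nhds (e.map_source hwe)] with v hv
  exact e.right_inv hv

lemma continuousAt_nearId (hT : TorusAnalyticOn T M) (hS : TorusAnalyticOn S M)
    {x : ℝ × Phase l j} (hx : x.2.2 ∈ M) :
    ContinuousAt (fun y : ℝ × Phase l j => nearId n T S y.1 y.2) x := by
  obtain ⟨z, rfl⟩ := paramMk_surjective x
  have h1 : ContinuousAt (fun z => (paramMk (nearIdLift n T S z)).2) z :=
    (continuous_snd.comp continuous_paramMk).continuousAt.comp
      (analyticAt_nearIdLift hT hS hx).continuousAt
  rw [ContinuousAt, ← map_paramMk_nhds, Filter.tendsto_map'_iff]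
  simpa only [ContinuousAt, paramMk_nearIdLift, Function.comp_def] using h1

lemma nearId_zero (hn : 1 ≤ n) (x : Phase l j) : nearId n T S 0 x = x := by
  have : n ≠ 0 := by omega
  simp [nearId, this, torusMk_zero]

/-- Equality on the torus only gives equality of lifts up to an integer vector. The neighbourhood is
chosen so that lifted images lie in a ball of radius 1/2, hence at distance less than 1, which
forces that vector to vanish. -/
lemma exists_nhds_injective_nearId (hn : 1 ≤ n) (hT : TorusAnalyticOn T M)
    (hS : TorusAnalyticOn S M) {x : Phase l j} (hx : x.2 ∈ M) :
    ∃ N ∈ 𝓝 ((0 : ℝ), x), ∀ (κ : ℝ) (y y' : Phase l j), (κ, y) ∈ N → (κ, y') ∈ N →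
      nearId n T S κ y = nearId n T S κ y' → y = y' := by
  obtain ⟨z, hz⟩ := paramMk_surjective ((0 : ℝ), x)
  have hz0 : z.2.2 = 0 := congrArg Prod.fst hz
  have hzM : z.2.1 ∈ M := by
    have : z.2.1 = x.2 := congrArg (fun y => y.2.2) hz
    rwa [this]
  obtain ⟨e, he, hze, hea⟩ := exists_openPartialHomeomorph_nearIdLift hn hT hS hzM hz0
  have hezz : e z = z := by rw [he, nearIdLift_of_param_eq_zero hn hz0]
  have hball : e.source ∩ e ⁻¹' Metric.ball z (1 / 2) ∈ 𝓝 z := by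
    refine Filter.inter_mem (e.open_source.mem_nhds hze) ?_
    have := e.continuousAt hze
    rw [ContinuousAt, hezz] at this
    exact this (Metric.ball_mem_nhds z (by norm_num))
  refine ⟨paramMk '' (e.source ∩ e ⁻¹' Metric.ball z (1 / 2)), ?_, ?_⟩
  · rw [← hz]
    exact isOpenMap_paramMk.image_mem_nhds hball
  · rintro κ y y' ⟨w, ⟨hw1, hw2⟩, hw⟩ ⟨w', ⟨hw1', hw2'⟩, hw'⟩ h
    have h1 : paramMk (nearIdLift n T S w) = paramMk (nearIdLift n T S w') := by
      rw [paramMk_nearIdLift, paramMk_nearIdLift, hw, hw', h]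
    rw [← he] at h1
    have h2 : (e w).1 = (e w').1 := by
      refine eq_of_torusMk_eq (congrArg (fun y => y.2.1) h1) ?_
      have : dist (e w) (e w') < 1 := by
        refine (dist_triangle_right _ _ z).trans_lt ?_
        rw [mem_preimage, Metric.mem_ball] at hw2 hw2'
        linarith
      rw [← dist_eq_norm]
      exact (le_max_left _ _).trans_lt this
    have h3 : e w = e w' := by
      refine Prod.ext h2 (Prod.ext ?_ ?_)
      · exact congrArg (fun y => y.2.2) h1
      · exact congrArg Prod.fst h1
    have h4 := e.injOn hw1 hw1' h3
    rw [h4, hw'] at hw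
    exact (congrArg Prod.snd hw).symm

variable {K : Set (Fin j → ℝ)}

/-- Compactness is applied to pairs of points: near a diagonal pair local injectivity holds, while
two distinct points have distinct images at κ = 0 and keep them nearby. -/
lemma eventually_injOn_nearId (hn : 1 ≤ n) (hT : TorusAnalyticOn T M) (hS : TorusAnalyticOn S M)
    (hK : IsCompact K) (hKM : K ⊆ M) :
    ∀ᶠ κ in 𝓝 (0 : ℝ), InjOn (nearId n T S κ) (univ ×ˢ K) := by
  have hC : IsCompact ((univ : Set (UnitAddTorus (Fin l))) ×ˢ K) := isCompact_univ.prod hK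
  have h := (hC.prod hC).eventually_forall_of_forall_eventually (x₀ := (0 : ℝ))
    (P := fun κ y => nearId n T S κ y.1 = nearId n T S κ y.2 → y.1 = y.2) (by
      rintro ⟨x, x'⟩ ⟨⟨-, hx⟩, ⟨-, hx'⟩⟩
      have c1 : Filter.Tendsto (fun z : ℝ × (Phase l j × Phase l j) => (z.1, z.2.1))
          (𝓝 (0, (x, x'))) (𝓝 (0, x)) := Continuous.tendsto (by fun_prop) _
      have c2 : Filter.Tendsto (fun z : ℝ × (Phase l j × Phase l j) => (z.1, z.2.2))
          (𝓝 (0, (x, x'))) (𝓝 (0, x')) := Continuous.tendsto (by fun_prop) _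
      by_cases hxx : x = x'
      · subst hxx
        obtain ⟨N, hN, hinj⟩ := exists_nhds_injective_nearId (n := n) hn hT hS (hKM hx)
        filter_upwards [c1 hN, c2 hN] with z h1 h2
        exact hinj _ _ _ h1 h2
      · have d1 := (continuousAt_nearId (n := n) hT hS (x := ((0 : ℝ), x)) (hKM hx)).tendsto.comp c1
        have d2 := (continuousAt_nearId (n := n) hT hS (x := ((0 : ℝ), x')) (hKM hx')).tendsto.comp c2
        simp only [nearId_zero hn] at d1 d2
        have := (d1.prodMk_nhds d2) (isClosed_diagonal.isOpen_compl.mem_nhds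
          (show (x, x') ∈ (diagonal (Phase l j))ᶜ from hxx))
        filter_upwards [this] with z hz hz'
        exact absurd hz' hz)
  filter_upwards [h] with κ hκ x hx x' hx' hxx
  exact hκ (x, x') ⟨hx, hx'⟩ hxx

/-- Near (0, x) the local inverse in all variables provides preimages close to x, hence over `V`;
compactness gives one range of κ. -/
lemma eventually_subset_image_nearId (hn : 1 ≤ n) (hT : TorusAnalyticOn T M)
    (hS : TorusAnalyticOn S M) (hK : IsCompact K) {V : Set (Fin j → ℝ)} (hV : IsOpen V)
    (hKV : K ⊆ V) (hKM : K ⊆ M) :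
    ∀ᶠ κ in 𝓝 (0 : ℝ), univ ×ˢ K ⊆ nearId n T S κ '' (univ ×ˢ V) := by
  have hC : IsCompact ((univ : Set (UnitAddTorus (Fin l))) ×ˢ K) := isCompact_univ.prod hK
  refine hC.eventually_forall_of_forall_eventually (x₀ := (0 : ℝ))
    (P := fun κ y => y ∈ nearId n T S κ '' (univ ×ˢ V)) ?_
  rintro x ⟨-, hx⟩
  obtain ⟨z, hz⟩ := paramMk_surjective ((0 : ℝ), x)
  have hz0 : z.2.2 = 0 := congrArg Prod.fst hz
  have hzx : z.2.1 = x.2 := congrArg (fun y => y.2.2) hz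
  obtain ⟨e, he, hze, hea⟩ :=
    exists_openPartialHomeomorph_nearIdLift hn hT hS (by rw [hzx]; exact hKM hx) hz0
  have hezz : e z = z := by rw [he, nearIdLift_of_param_eq_zero hn hz0]
  rw [← hz, ← map_paramMk_nhds, Filter.eventually_map]
  have hzt : z ∈ e.target := by rw [← hezz]; exact e.map_source hze
  have h1 : ∀ᶠ w in 𝓝 z, (e.symm w).2.1 ∈ V := by
    have h2 := (e.continuousAt_symm hzt)
    have h3 : e.symm z = z := by conv_lhs => rw [← hezz]; exact e.left_inv hze
    rw [ContinuousAt, h3] at h2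
    have hVo : IsOpen ((fun z : LiftedPhase l j => z.2.1) ⁻¹' V) := hV.preimage (by fun_prop)
    exact h2 (hVo.mem_nhds (show z.2.1 ∈ V by rw [hzx]; exact hKV hx))
  filter_upwards [h1, e.open_target.mem_nhds hzt] with w hw hwt
  refine ⟨(paramMk (e.symm w)).2, ⟨mem_univ _, hw⟩, ?_⟩
  have h4 : nearIdLift n T S (e.symm w) = w := by rw [← he]; exact e.right_inv hwt
  have h5 := paramMk_nearIdLift n T S (e.symm w)
  rw [h4] at h5
  have h6 : (paramMk (e.symm w)).1 = (paramMk w).1 := (congrArg Prod.fst h5).symm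
  rw [← h6]
  exact (congrArg Prod.snd h5).symm

lemma eventually_forall_hasAnalyticLocalInverse (hn : 1 ≤ n) (hT : TorusAnalyticOn T M)
    (hS : TorusAnalyticOn S M) (hK : IsCompact K) (hKM : K ⊆ M) :
    ∀ᶠ κ in 𝓝 (0 : ℝ), ∀ x ∈ (univ : Set (UnitAddTorus (Fin l))) ×ˢ K,
      HasAnalyticLocalInverse n T S (κ, x) :=
  (isCompact_univ.prod hK).eventually_forall_of_forall_eventually fun x hx =>
    eventually_hasAnalyticLocalInverse hn hT hS (x := x) (hKM hx.2)

lemma eventually_mapsTo_nearId (hn : 1 ≤ n) (hT : TorusAnalyticOn T M) (hS : TorusAnalyticOn S M)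
    (hM : IsOpen M) (hK : IsCompact K) (hKM : K ⊆ M) :
    ∀ᶠ κ in 𝓝 (0 : ℝ), ∀ x ∈ (univ : Set (UnitAddTorus (Fin l))) ×ˢ K,
      (nearId n T S κ x).2 ∈ M :=
  (isCompact_univ.prod hK).eventually_forall_of_forall_eventually fun x hx => by
    have h := (continuousAt_nearId (n := n) hT hS (x := ((0 : ℝ), x)) (hKM hx.2))
    have h2 := (continuous_snd.continuousAt.comp h).tendsto
    refine h2 (hM.mem_nhds ?_)
    simpa [nearId_zero hn] using hKM hx.2

end NearIdentity

/-! ### The given map on the covering space. -/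

section AveragedMap

variable {l j : ℕ}

/-- The lift of `averagedMap` to the covering space, with the parameter. -/
noncomputable def averagedLift (ω₀ : Fin l → ℝ) (r : ℕ)
    (Fb : ℕ → (Fin j → ℝ) → (Fin l → ℝ)) (Gb : ℕ → (Fin j → ℝ) → (Fin j → ℝ))
    (F : UnitAddTorus (Fin l) × ((Fin j → ℝ) × ℝ) → (Fin l → ℝ))
    (G : UnitAddTorus (Fin l) × ((Fin j → ℝ) × ℝ) → (Fin j → ℝ))
    (z : LiftedPhase l j) : LiftedPhase l j :=
  (z.1 + (ω₀ + (∑ i ∈ Finset.Ico 1 r, z.2.2 ^ i • Fb i z.2.1) + z.2.2 ^ r • F (torusMk z.1, z.2)),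
    (z.2.1 + (∑ i ∈ Finset.Ico 1 r, z.2.2 ^ i • Gb i z.2.1) + z.2.2 ^ r • G (torusMk z.1, z.2),
      z.2.2))

variable {ω₀ : Fin l → ℝ} {n : ℕ}
  {Fb : ℕ → (Fin j → ℝ) → (Fin l → ℝ)} {Gb : ℕ → (Fin j → ℝ) → (Fin j → ℝ)}
  {F : UnitAddTorus (Fin l) × ((Fin j → ℝ) × ℝ) → (Fin l → ℝ)}
  {G : UnitAddTorus (Fin l) × ((Fin j → ℝ) × ℝ) → (Fin j → ℝ)}
  {M : Set (Fin j → ℝ)} {a : ℝ}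

lemma paramMk_averagedLift (z : LiftedPhase l j) :
    paramMk (averagedLift ω₀ n Fb Gb F G z) =
      ((paramMk z).1, averagedMap ω₀ n Fb Gb F G (paramMk z).1 (paramMk z).2) := by
  simp [paramMk, averagedLift, averagedMap, torusMk_add]

lemma averagedMap_zero (hn : 1 ≤ n) (x : Phase l j) :
    averagedMap ω₀ n Fb Gb F G 0 x = (x.1 + torusMk ω₀, x.2) := by
  have h0 : n ≠ 0 := by omega
  have h1 : ∀ {d : ℕ} (B : ℕ → (Fin j → ℝ) → (Fin d → ℝ)),
      ∑ i ∈ Finset.Ico 1 n, (0 : ℝ) ^ i • B i x.2 = 0 := fun B =>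
    Finset.sum_eq_zero fun i hi => by
      have : i ≠ 0 := by have := (Finset.mem_Ico.1 hi).1; omega
      simp [this]
  simp [averagedMap, h1, h0]

lemma analyticAt_sum_pow_smul {d : ℕ} {B : ℕ → (Fin j → ℝ) → (Fin d → ℝ)}
    (hB : ∀ i, 1 ≤ i → i < n → AnalyticOnNhd ℝ (B i) M) {z : LiftedPhase l j} (hz : z.2.1 ∈ M) :
    AnalyticAt ℝ (fun z : LiftedPhase l j => ∑ i ∈ Finset.Ico 1 n, z.2.2 ^ i • B i z.2.1) z :=
  (Finset.Ico 1 n).analyticAt_fun_sum fun i hi => ((analyticAt_liftParam z).pow i).smul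
    (AnalyticAt.comp (f := fun z : LiftedPhase l j => z.2.1)
      (hB i (Finset.mem_Ico.1 hi).1 (Finset.mem_Ico.1 hi).2 _ hz) (analyticAt_liftSlow z))

lemma analyticAt_averagedLift (hFb : ∀ i, 1 ≤ i → i < n → AnalyticOnNhd ℝ (Fb i) M)
    (hGb : ∀ i, 1 ≤ i → i < n → AnalyticOnNhd ℝ (Gb i) M)
    (hF : TorusAnalyticOn F (M ×ˢ Ioo (-a) a)) (hG : TorusAnalyticOn G (M ×ˢ Ioo (-a) a))
    {z : LiftedPhase l j} (hz : z.2.1 ∈ M) (hz' : z.2.2 ∈ Ioo (-a) a) :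
    AnalyticAt ℝ (averagedLift ω₀ n Fb Gb F G) z := by
  have hk := (analyticAt_liftParam z).pow n
  refine (analyticAt_fst.add ((analyticAt_const.add (analyticAt_sum_pow_smul hFb hz)).add
    (hk.smul (hF z ⟨mem_univ _, hz, hz'⟩)))).prod ((((analyticAt_liftSlow z).add
      (analyticAt_sum_pow_smul hGb hz)).add (hk.smul (hG z ⟨mem_univ _, hz, hz'⟩))).prod
      (analyticAt_liftParam z))

variable {T : Phase l j → (Fin l → ℝ)} {S : Phase l j → (Fin j → ℝ)}

lemma analyticAt_averagedLift_comp_nearIdLift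
    (hFb : ∀ i, 1 ≤ i → i < n → AnalyticOnNhd ℝ (Fb i) M)
    (hGb : ∀ i, 1 ≤ i → i < n → AnalyticOnNhd ℝ (Gb i) M)
    (hF : TorusAnalyticOn F (M ×ˢ Ioo (-a) a)) (hG : TorusAnalyticOn G (M ×ˢ Ioo (-a) a))
    (hT : TorusAnalyticOn T M) (hS : TorusAnalyticOn S M)
    {z : LiftedPhase l j} (hz : z.2.1 ∈ M) (hz' : z.2.2 ∈ Ioo (-a) a)
    (hzM : (nearIdLift n T S z).2.1 ∈ M) :
    AnalyticAt ℝ (fun z => averagedLift ω₀ n Fb Gb F G (nearIdLift n T S z)) z :=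
  (analyticAt_averagedLift hFb hGb hF hG hzM hz').comp (analyticAt_nearIdLift hT hS hz)

/-- At κ = 0 the composition is the rotation by ω₀, which fixes the slow variable; continuity and
compactness extend this to small κ. -/
lemma eventually_mapsTo_averagedMap (hn : 1 ≤ n) (ha : 0 < a)
    (hFb : ∀ i, 1 ≤ i → i < n → AnalyticOnNhd ℝ (Fb i) M)
    (hGb : ∀ i, 1 ≤ i → i < n → AnalyticOnNhd ℝ (Gb i) M)
    (hF : TorusAnalyticOn F (M ×ˢ Ioo (-a) a)) (hG : TorusAnalyticOn G (M ×ˢ Ioo (-a) a))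
    (hT : TorusAnalyticOn T M) (hS : TorusAnalyticOn S M)
    {K V : Set (Fin j → ℝ)} (hK : IsCompact K) (hKM : K ⊆ M) (hV : IsOpen V) (hKV : K ⊆ V) :
    ∀ᶠ κ in 𝓝 (0 : ℝ), ∀ x ∈ (univ : Set (UnitAddTorus (Fin l))) ×ˢ K,
      (averagedMap ω₀ n Fb Gb F G κ (nearId n T S κ x)).2 ∈ V := by
  refine (isCompact_univ.prod hK).eventually_forall_of_forall_eventually fun x hx => ?_
  obtain ⟨z, hz⟩ := paramMk_surjective ((0 : ℝ), x)
  have hz0 : z.2.2 = 0 := congrArg Prod.fst hz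
  have hzx : z.2.1 = x.2 := congrArg (fun y => y.2.2) hz
  have hzM : z.2.1 ∈ M := by rw [hzx]; exact hKM hx.2
  have h1 := (continuous_snd.comp (continuous_snd.comp continuous_paramMk)).continuousAt.comp
    (analyticAt_averagedLift_comp_nearIdLift (ω₀ := ω₀) hFb hGb hF hG hT hS hzM
      (by rw [hz0]; exact ⟨by linarith, ha⟩)
      (by rwa [nearIdLift_of_param_eq_zero hn hz0])).continuousAt
  rw [← hz, ← map_paramMk_nhds, Filter.eventually_map]
  refine (h1.tendsto.eventually (hV.mem_nhds ?_)).mono fun w hw => ?_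
  · simp only [Function.comp_apply, paramMk_averagedLift, paramMk_nearIdLift, hz, nearId_zero hn,
      averagedMap_zero hn]
    exact hKV hx.2
  · have hw : (paramMk (averagedLift ω₀ n Fb Gb F G (nearIdLift n T S w))).2.2 ∈ V := hw
    rwa [paramMk_averagedLift, paramMk_nearIdLift] at hw

end AveragedMap

/-! ### The inverse transformation, analytic jointly in the parameter. -/

section InverseFamily

variable {l j : ℕ} {n : ℕ} {T : Phase l j → (Fin l → ℝ)} {S : Phase l j → (Fin j → ℝ)}
  {M U V : Set (Fin j → ℝ)} {κ₀ : ℝ}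

/-- The inverse of the near-identity transformation, restricted to `𝕋^l × V`. -/
noncomputable def nearIdInv (n : ℕ) (T : Phase l j → (Fin l → ℝ)) (S : Phase l j → (Fin j → ℝ))
    (V : Set (Fin j → ℝ)) (κ : ℝ) : Phase l j → Phase l j :=
  Function.invFunOn (nearId n T S κ) (univ ×ˢ V)

/-- On `𝕋^l × V` the near-identity transformations with `|κ| < κ₀` are injective and have analytic
local inverses. -/
structure IsInvertibleFamily (n : ℕ) (T : Phase l j → (Fin l → ℝ)) (S : Phase l j → (Fin j → ℝ))
    (V : Set (Fin j → ℝ)) (κ₀ : ℝ) : Prop where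
  isOpen : IsOpen V
  injOn : ∀ κ ∈ Ioo (-κ₀) κ₀, InjOn (nearId n T S κ) (univ ×ˢ V)
  localInverse : ∀ κ ∈ Ioo (-κ₀) κ₀, ∀ x ∈ (univ : Set (UnitAddTorus (Fin l))) ×ˢ V,
    HasAnalyticLocalInverse n T S (κ, x)

namespace IsInvertibleFamily

lemma nearIdInv_nearId (h : IsInvertibleFamily n T S V κ₀) {κ : ℝ} (hκ : κ ∈ Ioo (-κ₀) κ₀)
    {x : Phase l j} (hx : x.2 ∈ V) : nearIdInv n T S V κ (nearId n T S κ x) = x :=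
  (h.injOn κ hκ).leftInvOn_invFunOn ⟨mem_univ _, hx⟩

/-- The inverse transformation lifts to a map that is analytic jointly in the parameter. -/
lemma exists_lift_nearIdInv (h : IsInvertibleFamily n T S V κ₀) {κ : ℝ} (hκ : κ ∈ Ioo (-κ₀) κ₀)
    {x : Phase l j} (hx : x.2 ∈ V) {w₀ : LiftedPhase l j}
    (hw₀ : paramMk w₀ = (κ, nearId n T S κ x)) :
    ∃ g : LiftedPhase l j → LiftedPhase l j, AnalyticAt ℝ g w₀ ∧ (g w₀).2.1 ∈ V ∧
      ∀ᶠ w in 𝓝 w₀, paramMk (g w) = (w.2.2, nearIdInv n T S V w.2.2 (paramMk w).2) ∧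
        (paramMk w).2 ∈ nearId n T S w.2.2 '' (univ ×ˢ V) := by
  obtain ⟨z, g, hzx, hga, hgz, hg⟩ := h.localInverse κ hκ x ⟨mem_univ _, hx⟩
  -- The local inverse is centred at one lift of the image point, `w₀` is another; they differ by
  -- the deck translation `m`, with which the local inverse is precomposed.
  set m := nearIdLift n T S z - w₀ with hm
  have hz1 : (paramMk z).1 = κ := by rw [hzx]
  have hz2 : (paramMk z).2 = x := by rw [hzx]
  have hΛ : paramMk (nearIdLift n T S z) = paramMk w₀ := by
    rw [paramMk_nearIdLift, hz1, hz2, hw₀]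
  have hm1 : torusMk m.1 = 0 := by
    rw [hm, Prod.fst_sub, torusMk_sub, sub_eq_zero]
    exact congrArg (fun y => y.2.1) hΛ
  have hm2 : m.2 = 0 := by
    rw [hm, Prod.snd_sub, sub_eq_zero]
    exact Prod.ext (congrArg (fun y => y.2.2) hΛ) (congrArg (fun y => y.1) hΛ)
  have hpm : ∀ w, paramMk (w + m) = paramMk w := fun w => by
    simp only [paramMk, Prod.fst_add, Prod.snd_add, torusMk_add, hm1, hm2, add_zero]
  have hwm : w₀ + m = nearIdLift n T S z := by rw [hm]; abel
  have hga' : AnalyticAt ℝ (fun w => g (w + m)) w₀ :=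
    AnalyticAt.comp (g := g) (f := fun w => w + m) (by rwa [hwm])
      (analyticAt_id.add analyticAt_const)
  have hzV : z.2.1 ∈ V := by
    have : z.2.1 = x.2 := congrArg (fun y => y.2.2) hzx
    rwa [this]
  have hcont : Filter.Tendsto (fun w => w + m) (𝓝 w₀) (𝓝 (nearIdLift n T S z)) := by
    rw [← hwm]
    exact Continuous.tendsto (by fun_prop) _
  have hVo : IsOpen ((fun z : LiftedPhase l j => z.2.1) ⁻¹' V) := h.isOpen.preimage (by fun_prop)
  have hgw : g (w₀ + m) = z := by rw [hwm, hgz]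
  have hIo : IsOpen ((fun z : LiftedPhase l j => z.2.2) ⁻¹' Ioo (-κ₀) κ₀) :=
    isOpen_Ioo.preimage (by fun_prop)
  refine ⟨fun w => g (w + m), hga', by beta_reduce; rwa [hgw], ?_⟩
  have e1 : ∀ᶠ w in 𝓝 w₀, (g (w + m)).2.1 ∈ V := by
    refine hga'.continuousAt.eventually (hVo.mem_nhds ?_)
    change (g (w₀ + m)).2.1 ∈ V
    rwa [hgw]
  have e2 : ∀ᶠ w in 𝓝 w₀, w.2.2 ∈ Ioo (-κ₀) κ₀ := by
    refine hIo.mem_nhds ?_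
    have : w₀.2.2 = κ := congrArg Prod.fst hw₀
    rwa [mem_preimage, this]
  filter_upwards [e1, e2, hcont.eventually hg] with w hw1 hw2 hw3
  have h1 := paramMk_nearIdLift n T S (g (w + m))
  rw [hw3, hpm] at h1
  have h2 : (paramMk (g (w + m))).1 = w.2.2 := (congrArg Prod.fst h1).symm
  rw [h2] at h1
  have h3 : (paramMk w).2 = nearId n T S w.2.2 (paramMk (g (w + m))).2 := congrArg Prod.snd h1
  refine ⟨Prod.ext h2 ?_, ?_⟩
  · change _ = nearIdInv n T S V w.2.2 (paramMk w).2
    rw [h3, h.nearIdInv_nearId hw2 hw1]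
  · rw [h3]
    exact mem_image_of_mem _ ⟨mem_univ _, hw1⟩

lemma exists_phase_lift_nearIdInv (h : IsInvertibleFamily n T S V κ₀) {κ : ℝ}
    (hκ : κ ∈ Ioo (-κ₀) κ₀) {q : (Fin l → ℝ) × (Fin j → ℝ)}
    (hq : phaseMk q ∈ nearId n T S κ '' (univ ×ˢ V)) :
    ∃ g : (Fin l → ℝ) × (Fin j → ℝ) → (Fin l → ℝ) × (Fin j → ℝ), AnalyticAt ℝ g q ∧
      ∀ᶠ y in 𝓝 q, nearIdInv n T S V κ (phaseMk y) = phaseMk (g y) ∧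
        phaseMk y ∈ nearId n T S κ '' (univ ×ˢ V) := by
  obtain ⟨x, ⟨-, hx⟩, hxq⟩ := hq
  obtain ⟨g, hga, -, hg⟩ := h.exists_lift_nearIdInv hκ hx (w₀ := (q.1, (q.2, κ)))
    (by rw [hxq]; rfl)
  have hι : AnalyticAt ℝ (fun y : (Fin l → ℝ) × (Fin j → ℝ) => ((y.1, (y.2, κ)) : LiftedPhase l j))
      q := analyticAt_fst.prod (analyticAt_snd.prod analyticAt_const)
  have hg2 : AnalyticAt ℝ (fun y : (Fin l → ℝ) × (Fin j → ℝ) => g (y.1, (y.2, κ))) q :=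
    AnalyticAt.comp (g := g) (f := fun y : (Fin l → ℝ) × (Fin j → ℝ) =>
      ((y.1, (y.2, κ)) : LiftedPhase l j)) hga hι
  refine ⟨fun y => ((g (y.1, (y.2, κ))).1, (g (y.1, (y.2, κ))).2.1),
    (analyticAt_fst.comp hg2).prod ((analyticAt_liftSlow _).comp hg2), ?_⟩
  filter_upwards [hι.continuousAt.eventually hg] with y hy
  exact ⟨(congrArg Prod.snd hy.1).symm, hy.2⟩

lemma map_phaseMk_nhds (q : (Fin l → ℝ) × (Fin j → ℝ)) :
    Filter.map phaseMk (𝓝 q) = 𝓝 (phaseMk q) :=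
  isOpenMap_phaseMk.map_nhds_eq continuous_phaseMk.continuousAt

/-- The near-identity transformation as a homeomorphism of `𝕋^l × V` onto its image. -/
noncomputable def toOpenPartialHomeomorph (h : IsInvertibleFamily n T S V κ₀)
    (hT : TorusAnalyticOn T M) (hS : TorusAnalyticOn S M) (hVM : V ⊆ M) {κ : ℝ}
    (hκ : κ ∈ Ioo (-κ₀) κ₀) : OpenPartialHomeomorph (Phase l j) (Phase l j) where
  toFun := nearId n T S κ
  invFun := nearIdInv n T S V κ
  source := univ ×ˢ V
  target := nearId n T S κ '' (univ ×ˢ V)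
  map_source' := fun x hx => mem_image_of_mem _ hx
  map_target' := by
    rintro _ ⟨x, hx, rfl⟩
    rwa [h.nearIdInv_nearId hκ hx.2]
  left_inv' := fun x hx => h.nearIdInv_nearId hκ hx.2
  right_inv' := by
    rintro _ ⟨x, hx, rfl⟩
    rw [h.nearIdInv_nearId hκ hx.2]
  open_source := isOpen_univ.prod h.isOpen
  open_target := by
    rw [isOpen_iff_mem_nhds]
    intro y hy
    obtain ⟨q, rfl⟩ := phaseMk_surjective y
    obtain ⟨g, -, hg⟩ := h.exists_phase_lift_nearIdInv hκ hy
    rw [← map_phaseMk_nhds, Filter.mem_map]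
    exact hg.mono fun y hy => hy.2
  continuousOn_toFun := by
    intro x hx
    exact (ContinuousAt.comp (f := fun x : Phase l j => (κ, x)) (x := x)
      (continuousAt_nearId hT hS (x := (κ, x)) (hVM hx.2)) (by fun_prop)).continuousWithinAt
  continuousOn_invFun := by
    intro y hy
    obtain ⟨q, rfl⟩ := phaseMk_surjective y
    obtain ⟨g, hga, hg⟩ := h.exists_phase_lift_nearIdInv hκ hy
    refine ContinuousAt.continuousWithinAt ?_
    rw [ContinuousAt, ← map_phaseMk_nhds, Filter.tendsto_map'_iff, hg.self_of_nhds.1]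
    refine ((continuous_phaseMk.continuousAt.comp hga.continuousAt).tendsto).congr' ?_
    exact hg.mono fun y hy => hy.1.symm

lemma isAnalyticDiffeo_symm (h : IsInvertibleFamily n T S V κ₀)
    (hT : TorusAnalyticOn T M) (hS : TorusAnalyticOn S M) (hVM : V ⊆ M) {κ : ℝ}
    (hκ : κ ∈ Ioo (-κ₀) κ₀) :
    IsAnalyticDiffeo (h.toOpenPartialHomeomorph hT hS hVM hκ).symm := by
  constructor
  · intro q hq
    obtain ⟨g, hga, hg⟩ := h.exists_phase_lift_nearIdInv hκ hq
    exact ⟨g, hga, hg.mono fun y hy => hy.1⟩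
  · intro q hq
    have hq' : q.2 ∈ M := hVM hq.2
    have hι : AnalyticAt ℝ (fun y : (Fin l → ℝ) × (Fin j → ℝ) =>
        ((y.1, (y.2, κ)) : LiftedPhase l j)) q :=
      analyticAt_fst.prod (analyticAt_snd.prod analyticAt_const)
    have h2 : AnalyticAt ℝ (fun y : (Fin l → ℝ) × (Fin j → ℝ) =>
        nearIdLift n T S (y.1, (y.2, κ))) q :=
      AnalyticAt.comp (g := nearIdLift n T S) (f := fun y : (Fin l → ℝ) × (Fin j → ℝ) =>
        ((y.1, (y.2, κ)) : LiftedPhase l j)) (analyticAt_nearIdLift hT hS hq') hι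
    refine ⟨_, (analyticAt_fst.comp h2).prod ((analyticAt_liftSlow _).comp h2),
      Filter.Eventually.of_forall fun y => ?_⟩
    exact (congrArg Prod.snd (paramMk_nearIdLift n T S (y.1, (y.2, κ)))).symm

/-- An analytic function composed with a family of maps into the range of the near-identity
transformation and the inverse transformation. -/
lemma analyticAt_comp_nearIdInv (h : IsInvertibleFamily n T S V κ₀) {E : Type*}
    [NormedAddCommGroup E] [NormedSpace ℝ E] {W : Phase l j → E} (hW : TorusAnalyticOn W V)
    {A : LiftedPhase l j → LiftedPhase l j} {z : LiftedPhase l j} (hA : AnalyticAt ℝ A z)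
    (hκ : (A z).2.2 ∈ Ioo (-κ₀) κ₀)
    (hz : (paramMk (A z)).2 ∈ nearId n T S (A z).2.2 '' (univ ×ˢ V)) :
    AnalyticAt ℝ (fun z => W (nearIdInv n T S V (A z).2.2 (paramMk (A z)).2)) z := by
  obtain ⟨x, ⟨-, hx⟩, hxz⟩ := hz
  obtain ⟨g, hga, hgV, hg⟩ := h.exists_lift_nearIdInv hκ hx (w₀ := A z) (by rw [hxz]; rfl)
  have h1 : AnalyticAt ℝ (fun z => W (torusMk (g (A z)).1, (g (A z)).2.1)) z :=
    AnalyticAt.comp (f := fun z => g (A z)) (hW.analyticAt_comp_lift hgV) (hga.comp hA)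
  refine h1.congr ?_
  filter_upwards [hA.continuousAt.eventually hg] with w hw
  have : (torusMk (g (A w)).1, (g (A w)).2.1) = nearIdInv n T S V (A w).2.2 (paramMk (A w)).2 :=
    congrArg Prod.snd hw.1
  rw [this]

end IsInvertibleFamily

end InverseFamily

/-! ### The remainder of order n + 1. -/

section Remainder

variable {l j d : ℕ} {ω₀ : Fin l → ℝ} {n : ℕ}
  {Fb : ℕ → (Fin j → ℝ) → (Fin l → ℝ)} {Gb : ℕ → (Fin j → ℝ) → (Fin j → ℝ)}
  {F : UnitAddTorus (Fin l) × ((Fin j → ℝ) × ℝ) → (Fin l → ℝ)}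
  {G : UnitAddTorus (Fin l) × ((Fin j → ℝ) × ℝ) → (Fin j → ℝ)}
  {M U V : Set (Fin j → ℝ)} {a κ₀ : ℝ}
  {T : Phase l j → (Fin l → ℝ)} {S : Phase l j → (Fin j → ℝ)}

/-- The step `s` is an independent variable, so that division by `s` applies; it is later set to κⁿ.
-/
lemma exists_increment_eq_smul {B : (Fin j → ℝ) → (Fin d → ℝ)} (hB : AnalyticOnNhd ℝ B M)
    (hS : TorusAnalyticOn S M) (hUM : U ⊆ M)
    (hstay : ∀ s ∈ Ioo (-κ₀) κ₀, ∀ θ, ∀ I ∈ U, I + s • S (θ, I) ∈ M) :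
    ∃ q : UnitAddTorus (Fin l) × ((Fin j → ℝ) × ℝ) → (Fin d → ℝ),
      TorusAnalyticOn q (U ×ˢ Ioo (-κ₀) κ₀) ∧
      ∀ θ, ∀ I ∈ U, ∀ s ∈ Ioo (-κ₀) κ₀, B (I + s • S (θ, I)) - B I = s • q (θ, (I, s)) := by
  have h : TorusAnalyticOn (fun z : UnitAddTorus (Fin l) × ((Fin j → ℝ) × ℝ) =>
      B (z.2.1 + z.2.2 • S (z.1, z.2.1)) - B z.2.1) (U ×ˢ Ioo (-κ₀) κ₀) := by
    rintro z ⟨-, hzU, hzs⟩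
    refine AnalyticAt.sub ?_ ?_
    · exact AnalyticAt.comp (g := B) (f := fun z : LiftedPhase l j =>
        z.2.1 + z.2.2 • S (torusMk z.1, z.2.1)) (hB _ (hstay _ hzs _ _ hzU))
        ((analyticAt_liftSlow z).add ((analyticAt_liftParam z).smul
          (hS.analyticAt_comp_lift (hUM hzU))))
    · exact AnalyticAt.comp (g := B) (hB _ (hUM hzU)) (analyticAt_liftSlow z)
  obtain ⟨q, hq, hq'⟩ := h.exists_eq_smul (fun θ y _ => by simp)
  exact ⟨q, hq, hq'⟩

/-- The hypotheses on the domains and on the parameter under which the transformed map is defined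
and has an analytic remainder. -/
structure IsAdmissible (n : ℕ) (T : Phase l j → (Fin l → ℝ)) (S : Phase l j → (Fin j → ℝ))
    (f : ℝ → Phase l j → Phase l j) (U V M : Set (Fin j → ℝ)) (κ₀ a : ℝ) : Prop where
  pos : 0 < κ₀
  family : IsInvertibleFamily n T S V κ₀
  subset_left : U ⊆ V
  subset_right : V ⊆ M
  le_one : κ₀ ≤ 1
  le_bound : κ₀ ≤ a
  mapsTo_slow : ∀ s ∈ Ioo (-κ₀) κ₀, ∀ θ, ∀ I ∈ V, I + s • S (θ, I) ∈ M
  mapsTo_range : ∀ κ ∈ Ioo (-κ₀) κ₀, ∀ x ∈ (univ : Set (UnitAddTorus (Fin l))) ×ˢ U,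
    f κ (nearId n T S κ x) ∈ nearId n T S κ '' (univ ×ˢ V)

lemma pow_mem_Ioo_of_le_one (hn : 1 ≤ n) (h1 : κ₀ ≤ 1) {κ : ℝ} (hκ : κ ∈ Ioo (-κ₀) κ₀) :
    κ ^ n ∈ Ioo (-κ₀) κ₀ := by
  rw [mem_Ioo, ← abs_lt] at hκ ⊢
  rw [abs_pow]
  exact (pow_le_of_le_one (abs_nonneg κ) (hκ.le.trans h1) (by omega)).trans_lt hκ

/-- The remainder of order `n + 1` of one component of the transformed map. -/
theorem IsAdmissible.exists_remainder (hn : 1 ≤ n) (ha : 0 < a) (hM : IsOpen M)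
    (h : IsAdmissible n T S (averagedMap ω₀ n Fb Gb F G) U V M κ₀ a)
    (hFb : ∀ i, 1 ≤ i → i < n → AnalyticOnNhd ℝ (Fb i) M)
    (hGb : ∀ i, 1 ≤ i → i < n → AnalyticOnNhd ℝ (Gb i) M)
    (hF : TorusAnalyticOn F (M ×ˢ Ioo (-a) a)) (hG : TorusAnalyticOn G (M ×ˢ Ioo (-a) a))
    (hT : TorusAnalyticOn T M) (hS : TorusAnalyticOn S M)
    {B : ℕ → (Fin j → ℝ) → (Fin d → ℝ)} (hB : ∀ i, 1 ≤ i → i < n → AnalyticOnNhd ℝ (B i) M)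
    {P : UnitAddTorus (Fin l) × ((Fin j → ℝ) × ℝ) → (Fin d → ℝ)}
    (hP : TorusAnalyticOn P (M ×ˢ Ioo (-a) a))
    {W : Phase l j → (Fin d → ℝ)} (hW : TorusAnalyticOn W M)
    (hWP : ∀ θ, ∀ I ∈ M, W (θ + torusMk ω₀, I) - W (θ, I) = P (θ, (I, 0)) - angleAverage P I) :
    ∃ R : UnitAddTorus (Fin l) × ((Fin j → ℝ) × ℝ) → (Fin d → ℝ),
      TorusAnalyticOn R (U ×ˢ Ioo (-κ₀) κ₀) ∧
      ∀ κ ∈ Ioo (-κ₀) κ₀, ∀ x ∈ (univ : Set (UnitAddTorus (Fin l))) ×ˢ U,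
        (∑ i ∈ Finset.Ico 1 n, κ ^ i • B i (nearId n T S κ x).2) +
          κ ^ n • P ((nearId n T S κ x).1, ((nearId n T S κ x).2, κ)) + κ ^ n • W x -
          κ ^ n • W (nearIdInv n T S V κ (averagedMap ω₀ n Fb Gb F G κ (nearId n T S κ x))) =
        (∑ i ∈ Finset.Ico 1 (n + 1), κ ^ i • Function.update B n (angleAverage P) i x.2) +
          κ ^ (n + 1) • R (x.1, (x.2, κ)) := by
  have hUM := h.subset_left.trans h.subset_right
  have hIoo : ∀ κ ∈ Ioo (-κ₀) κ₀, κ ∈ Ioo (-a) a := fun κ hκ =>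
    Ioo_subset_Ioo (neg_le_neg h.le_bound) h.le_bound hκ
  have hinc : ∀ i, ∃ q : UnitAddTorus (Fin l) × ((Fin j → ℝ) × ℝ) → (Fin d → ℝ),
      1 ≤ i → i < n → TorusAnalyticOn q (U ×ˢ Ioo (-κ₀) κ₀) ∧
      ∀ θ, ∀ I ∈ U, ∀ s ∈ Ioo (-κ₀) κ₀, B i (I + s • S (θ, I)) - B i I = s • q (θ, (I, s)) := by
    intro i
    by_cases hi : 1 ≤ i ∧ i < n
    · obtain ⟨q, hq⟩ := exists_increment_eq_smul (l := l) (U := U) (κ₀ := κ₀) (hB i hi.1 hi.2) hS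
        hUM (fun s hs θ I hI => h.mapsTo_slow s hs θ I (h.subset_left hI))
      exact ⟨q, fun _ _ => hq⟩
    -- Default value for indices outside the sum.
    · exact ⟨0, fun h1 h2 => absurd ⟨h1, h2⟩ hi⟩
  choose q hq using hinc
  -- This is the coefficient of κⁿ, still depending on κ, minus the mean; it includes W at the
  -- transformed point.
  have hmain : TorusAnalyticOn (fun z : UnitAddTorus (Fin l) × ((Fin j → ℝ) × ℝ) =>
      P ((nearId n T S z.2.2 (z.1, z.2.1)).1, ((nearId n T S z.2.2 (z.1, z.2.1)).2, z.2.2)) +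
        W (z.1, z.2.1) - W (nearIdInv n T S V z.2.2 (averagedMap ω₀ n Fb Gb F G z.2.2
          (nearId n T S z.2.2 (z.1, z.2.1)))) - angleAverage P z.2.1) (U ×ˢ Ioo (-κ₀) κ₀) := by
    rintro z ⟨-, hzU, hzκ⟩
    have hzM := hUM hzU
    have hzS : (nearIdLift n T S z).2.1 ∈ M :=
      h.mapsTo_slow _ (pow_mem_Ioo_of_le_one hn h.le_one hzκ) _ _ (h.subset_left hzU)
    have hza := hIoo _ hzκ
    refine ((AnalyticAt.add ?_ (hW.analyticAt_comp_lift hzM)).sub ?_).sub ?_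
    · have h1 : AnalyticAt ℝ (fun z => P (torusMk (nearIdLift n T S z).1,
          (nearIdLift n T S z).2)) z :=
        AnalyticAt.comp (f := nearIdLift n T S) (hP (nearIdLift n T S z) ⟨mem_univ _, hzS, hza⟩)
          (analyticAt_nearIdLift hT hS hzM)
      simpa only [nearIdLift, nearId, torusMk_add] using h1
    · have e : ∀ z : LiftedPhase l j,
          paramMk (averagedLift ω₀ n Fb Gb F G (nearIdLift n T S z)) =
          (z.2.2, averagedMap ω₀ n Fb Gb F G z.2.2 (nearId n T S z.2.2 (torusMk z.1, z.2.1))) :=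
        fun z => by rw [paramMk_averagedLift, paramMk_nearIdLift]; rfl
      have h1 := h.family.analyticAt_comp_nearIdInv (W := W)
        (fun p hp => hW p ⟨mem_univ _, h.subset_right hp.2⟩)
        (analyticAt_averagedLift_comp_nearIdLift (ω₀ := ω₀) hFb hGb hF hG hT hS hzM hza hzS)
        hzκ (by rw [e]; exact h.mapsTo_range _ hzκ _ ⟨mem_univ _, hzU⟩)
      simp only [e] at h1
      exact h1
    -- The mean is analytic because the homological equation expresses it through P and W; openness
    -- of `M` makes this valid near the point.
    · have h1 : AnalyticAt ℝ (fun z : LiftedPhase l j => P (torusMk z.1, (z.2.1, 0)) -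
          (W (torusMk (z.1 + ω₀), z.2.1) - W (torusMk z.1, z.2.1))) z := by
        refine AnalyticAt.sub ?_ (AnalyticAt.sub ?_ (hW.analyticAt_comp_lift hzM))
        · exact AnalyticAt.comp (f := fun z : LiftedPhase l j =>
            ((z.1, (z.2.1, 0)) : LiftedPhase l j))
            (hP (z.1, (z.2.1, 0)) ⟨mem_univ _, hzM, ⟨neg_lt_zero.2 ha, ha⟩⟩)
            (analyticAt_fst.prod ((analyticAt_liftSlow z).prod analyticAt_const))
        · exact AnalyticAt.comp (f := fun z : LiftedPhase l j =>
            ((z.1 + ω₀, z.2) : LiftedPhase l j))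
            (hW.analyticAt_comp_lift (z := (z.1 + ω₀, z.2)) hzM)
            ((analyticAt_fst.add analyticAt_const).prod analyticAt_snd)
      refine h1.congr ?_
      have hMo : IsOpen ((fun z : LiftedPhase l j => z.2.1) ⁻¹' M) := hM.preimage (by fun_prop)
      filter_upwards [hMo.mem_nhds hzM] with w hw
      rw [torusMk_add, hWP _ _ hw, sub_sub_cancel]
  -- At κ = 0 the transformation and its inverse are the identity and the map is the rotation, so
  -- the expression vanishes by the homological equation.
  obtain ⟨b, hb, hb'⟩ := hmain.exists_eq_smul (fun θ I hI => by
    have e := h.family.nearIdInv_nearId (κ := 0) (x := (θ + torusMk ω₀, I)) ?_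
      (h.subset_left hI)
    · rw [nearId_zero hn] at e
      simp only [nearId_zero hn, averagedMap_zero hn, e]
      have := hWP θ I (hUM hI)
      linear_combination -this
    · exact ⟨neg_lt_zero.2 h.pos, h.pos⟩)
  -- The increments contribute κ^i · κⁿ · q_i = κ^(n+1) · κ^(i−1) · q_i; the truncated subtraction
  -- is exact since i ≥ 1.
  refine ⟨fun z => (∑ i ∈ Finset.Ico 1 n, z.2.2 ^ (i - 1) • q i (z.1, (z.2.1, z.2.2 ^ n))) + b z,
    ?_, ?_⟩
  · rintro z ⟨-, hzU, hzκ⟩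
    refine AnalyticAt.add ?_ (hb z ⟨mem_univ _, hzU, hzκ⟩)
    refine (Finset.Ico 1 n).analyticAt_fun_sum fun i hi =>
      ((analyticAt_liftParam z).pow (i - 1)).smul ?_
    obtain ⟨h1, h2⟩ := Finset.mem_Ico.1 hi
    exact AnalyticAt.comp (f := fun z : LiftedPhase l j =>
      ((z.1, (z.2.1, z.2.2 ^ n)) : LiftedPhase l j))
      ((hq i h1 h2).1 (z.1, (z.2.1, z.2.2 ^ n))
        ⟨mem_univ _, hzU, pow_mem_Ioo_of_le_one hn h.le_one hzκ⟩)
      (analyticAt_fst.prod ((analyticAt_liftSlow z).prod ((analyticAt_liftParam z).pow n)))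
  · rintro κ hκ ⟨θ, I⟩ ⟨-, hI⟩
    have hI : I ∈ U := hI
    have e1 := hb' θ I hI κ hκ
    have e2 : ∑ i ∈ Finset.Ico 1 n, κ ^ i • B i (nearId n T S κ (θ, I)).2 =
        (∑ i ∈ Finset.Ico 1 n, κ ^ i • B i I) +
        κ ^ (n + 1) • ∑ i ∈ Finset.Ico 1 n, κ ^ (i - 1) • q i (θ, (I, κ ^ n)) := by
      rw [Finset.smul_sum, ← Finset.sum_add_distrib]
      refine Finset.sum_congr rfl fun i hi => ?_
      obtain ⟨h1, h2⟩ := Finset.mem_Ico.1 hi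
      have e3 := (hq i h1 h2).2 θ I hI (κ ^ n) (pow_mem_Ioo_of_le_one hn h.le_one hκ)
      rw [sub_eq_iff_eq_add] at e3
      rw [nearId, e3, smul_add, add_comm, smul_smul, smul_smul, ← pow_add, ← pow_add]
      congr 3
      omega
    have e4 : ∑ i ∈ Finset.Ico 1 (n + 1), κ ^ i • Function.update B n (angleAverage P) i I =
        (∑ i ∈ Finset.Ico 1 n, κ ^ i • B i I) + κ ^ n • angleAverage P I := by
      rw [Finset.sum_Ico_succ_top hn, Function.update_self]
      congr 1
      refine Finset.sum_congr rfl fun i hi => ?_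
      rw [Function.update_of_ne (Finset.mem_Ico.1 hi).2.ne]
    rw [e2, e4, smul_add (κ ^ (n + 1)), pow_succ κ n, mul_smul _ _ (b _), ← e1]
    simp only [smul_sub, smul_add]
    abel

end Remainder

/-! ### The decoupling transformation. -/

theorem mainTheorem2 (l j n : ℕ) (hn : 1 ≤ n)
    (c μ : ℝ) (hc : 0 < c) (hμ : 0 < μ)
    (ω₀ : Fin l → ℝ) (hω : ω₀ ∈ diophantine l c μ)
    (M : Set (Fin j → ℝ)) (hM : IsOpen M) (a : ℝ) (ha : 0 < a)
    (Fb : ℕ → (Fin j → ℝ) → (Fin l → ℝ)) (Gb : ℕ → (Fin j → ℝ) → (Fin j → ℝ))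
    (hFb : ∀ i, 1 ≤ i → i < n → AnalyticOnNhd ℝ (Fb i) M)
    (hGb : ∀ i, 1 ≤ i → i < n → AnalyticOnNhd ℝ (Gb i) M)
    (F : UnitAddTorus (Fin l) × ((Fin j → ℝ) × ℝ) → (Fin l → ℝ))
    (G : UnitAddTorus (Fin l) × ((Fin j → ℝ) × ℝ) → (Fin j → ℝ))
    (hF : TorusAnalyticOn F (M ×ˢ Ioo (-a) a))
    (hG : TorusAnalyticOn G (M ×ˢ Ioo (-a) a)) :
    ∃ (T : Phase l j → (Fin l → ℝ)) (S : Phase l j → (Fin j → ℝ)),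
      TorusAnalyticOn T M ∧ TorusAnalyticOn S M ∧
      ∀ K : Set (Fin j → ℝ), IsCompact K → K ⊆ M →
        ∃ (κ₀ : ℝ) (U V : Set (Fin j → ℝ))
          (F' : UnitAddTorus (Fin l) × ((Fin j → ℝ) × ℝ) → (Fin l → ℝ))
          (G' : UnitAddTorus (Fin l) × ((Fin j → ℝ) × ℝ) → (Fin j → ℝ)),
          0 < κ₀ ∧ κ₀ ≤ a ∧ IsOpen U ∧ IsOpen V ∧ K ⊆ U ∧ U ⊆ V ∧ V ⊆ M ∧
          TorusAnalyticOn F' (U ×ˢ Ioo (-κ₀) κ₀) ∧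
          TorusAnalyticOn G' (U ×ˢ Ioo (-κ₀) κ₀) ∧
          ∀ κ : ℝ, |κ| < κ₀ →
            ∃ h : OpenPartialHomeomorph (Phase l j) (Phase l j),
              IsAnalyticDiffeo h ∧
              h.source ⊆ univ ×ˢ M ∧ h.target = univ ×ˢ V ∧
              (∀ x ∈ h.target,
                h.symm x = (x.1 + torusMk (κ ^ n • T x), x.2 + κ ^ n • S x)) ∧
              univ ×ˢ K ⊆ h.symm '' (univ ×ˢ U) ∧
              ∀ x ∈ (univ : Set (UnitAddTorus (Fin l))) ×ˢ U,
                averagedMap ω₀ n Fb Gb F G κ (h.symm x) ∈ h.source ∧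
                h (averagedMap ω₀ n Fb Gb F G κ (h.symm x)) =
                  averagedMap ω₀ (n + 1)
                    (Function.update Fb n (angleAverage F))
                    (Function.update Gb n (angleAverage G)) F' G' κ x := by
  have hslice : ∀ {d : ℕ} {P : UnitAddTorus (Fin l) × ((Fin j → ℝ) × ℝ) → (Fin d → ℝ)},
      TorusAnalyticOn P (M ×ˢ Ioo (-a) a) →
      TorusAnalyticOn (fun q : Phase l j => P (q.1, (q.2, 0))) M := fun hP p hp =>
    AnalyticAt.comp (f := fun p : (Fin l → ℝ) × (Fin j → ℝ) => ((p.1, (p.2, 0)) : LiftedPhase l j))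
      (hP (p.1, (p.2, 0)) ⟨mem_univ _, hp.2, ⟨neg_lt_zero.2 ha, ha⟩⟩)
      (analyticAt_fst.prod (analyticAt_snd.prod analyticAt_const))
  obtain ⟨T, hT, hTF⟩ := exists_homologicalSolution_pi (hslice hF) hc hω
  obtain ⟨S, hS, hSG⟩ := exists_homologicalSolution_pi (hslice hG) hc hω
  refine ⟨T, S, hT, hS, fun K hK hKM => ?_⟩
  -- U and V will be the interiors of K₁ and K₃. The intermediate K₂ absorbs the motion: in the slow
  -- variable, transformed points over K₁ are mapped into K₂, and 𝕋^l × K₂ is covered by the image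
  -- of 𝕋^l × V.
  obtain ⟨K₁, hK₁, hKK₁, hK₁M⟩ := exists_compact_between hK hM hKM
  obtain ⟨K₂, hK₂, hK₁₂, hK₂M⟩ := exists_compact_between hK₁ hM hK₁M
  obtain ⟨K₃, hK₃, hK₂₃, hK₃M⟩ := exists_compact_between hK₂ hM hK₂M
  have hev := ((eventually_injOn_nearId hn hT hS hK₃ hK₃M).and
    (eventually_forall_hasAnalyticLocalInverse hn hT hS hK₃ hK₃M)).and
    -- Used with exponent 1: I + sS must stay in `M` for every |s| < κ₀, not only for s = κⁿ.
    (((eventually_mapsTo_nearId le_rfl hT hS hM hK₃ hK₃M).and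
      (eventually_subset_image_nearId hn hT hS hK isOpen_interior hKK₁ hKM)).and
      ((eventually_mapsTo_averagedMap (ω₀ := ω₀) hn ha hFb hGb hF hG hT hS hK₁ hK₁M
          isOpen_interior hK₁₂).and
        (eventually_subset_image_nearId hn hT hS hK₂ isOpen_interior hK₂₃ hK₂M)))
  obtain ⟨ε, hε, hball⟩ := Metric.eventually_nhds_iff.1 hev
  -- The bound 1 ensures |κⁿ| ≤ |κ| < κ₀.
  have hκ₀ : 0 < min ε (min 1 a) := lt_min hε (lt_min one_pos ha)
  set κ₀ := min ε (min 1 a)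
  have hgood : ∀ κ ∈ Ioo (-κ₀) κ₀, dist κ 0 < ε := fun κ hκ => by
    rw [dist_zero_right, Real.norm_eq_abs]
    exact (abs_lt.2 hκ).trans_le (min_le_left _ _)
  have hVK : interior K₃ ⊆ K₃ := interior_subset
  have hadm : IsAdmissible n T S (averagedMap ω₀ n Fb Gb F G) (interior K₁) (interior K₃) M κ₀ a :=
    { pos := hκ₀
      family :=
        { isOpen := isOpen_interior
          injOn := fun κ hκ => (hball (hgood κ hκ)).1.1.mono (prod_mono_right hVK)
          localInverse := fun κ hκ x hx => (hball (hgood κ hκ)).1.2 x ⟨hx.1, hVK hx.2⟩ }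
      subset_left := interior_subset.trans (hK₁₂.trans (interior_subset.trans hK₂₃))
      subset_right := hVK.trans hK₃M
      le_one := (min_le_right _ _).trans (min_le_left _ _)
      le_bound := (min_le_right _ _).trans (min_le_right _ _)
      mapsTo_slow := fun s hs θ I hI => by
        simpa [nearId] using (hball (hgood s hs)).2.1.1 (θ, I) ⟨mem_univ _, hVK hI⟩
      mapsTo_range := fun κ hκ x hx => by
        refine (hball (hgood κ hκ)).2.2.2 ⟨mem_univ _, interior_subset ?_⟩
        exact (hball (hgood κ hκ)).2.2.1 x ⟨hx.1, interior_subset hx.2⟩ }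
  obtain ⟨F', hF', hF'eq⟩ := hadm.exists_remainder hn ha hM hFb hGb hF hG hT hS hFb hF hT hTF
  obtain ⟨G', hG', hG'eq⟩ := hadm.exists_remainder hn ha hM hFb hGb hF hG hT hS hGb hG hS hSG
  refine ⟨κ₀, interior K₁, interior K₃, F', G', hκ₀, hadm.le_bound, isOpen_interior,
    isOpen_interior, hKK₁, hadm.subset_left, hadm.subset_right, hF', hG', fun κ hκ => ?_⟩
  have hκ := abs_lt.1 hκ
  have hfam := hadm.family
  refine ⟨(hfam.toOpenPartialHomeomorph hT hS hadm.subset_right hκ).symm,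
    hfam.isAnalyticDiffeo_symm hT hS hadm.subset_right hκ, ?_, rfl, fun x _ => rfl,
    (hball (hgood κ hκ)).2.1.2, fun x hx => ⟨hadm.mapsTo_range κ hκ x hx, ?_⟩⟩
  · rintro _ ⟨x, hx, rfl⟩
    exact ⟨mem_univ _, hadm.mapsTo_slow _ (pow_mem_Ioo_of_le_one hn hadm.le_one hκ) _ _ hx.2⟩
  · change nearIdInv n T S (interior K₃) κ (averagedMap ω₀ n Fb Gb F G κ (nearId n T S κ x)) = _
    have eF := hF'eq κ hκ x hx
    have eG := hG'eq κ hκ x hx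
    -- The transformed image x' is known only implicitly, by ψ' = θ' − κⁿT(x') and I' = J' −
    -- κⁿS(x'); the remainder identities already contain these last terms.
    obtain ⟨x', hx', hxx⟩ := hadm.mapsTo_range κ hκ x hx
    rw [← hxx, hfam.nearIdInv_nearId hκ hx'.2] at eF eG ⊢
    have h1 := congrArg Prod.fst hxx
    have h2 := congrArg Prod.snd hxx
    refine Prod.ext ?_ ?_
    · have h3 : x'.1 = (averagedMap ω₀ n Fb Gb F G κ (nearId n T S κ x)).1 -
          torusMk (κ ^ n • T x') := by
        rw [← h1]; simp [nearId]
      rw [h3]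
      simp only [averagedMap, add_assoc ω₀, ← eF]
      simp only [nearId, torusMk_add, torusMk_sub]
      abel
    · have h3 : x'.2 = (averagedMap ω₀ n Fb Gb F G κ (nearId n T S κ x)).2 -
          κ ^ n • S x' := by
        rw [← h2]; simp [nearId]
      rw [h3]
      simp only [averagedMap, add_assoc x.2, ← eG]
      simp only [nearId]
      abel
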